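/- Let $\mathcal H=\mathbb C^d$, $d\ge 2$, with computational basis $\{|j\rangle\}_{j=0}^{d-1}$, and let $\mathscr D^{\mathrm R}(\mathcal H)$ be the set of density matrices on $\mathcal H$ (positive semidefinite matrices of trace one) all of whose entries in this basis are real. Let $\mathcal H_A$, $\mathcal H_B$ be finite-dimensional Hilbert spaces with fixed bases. A (complex) masker for $\mathscr D^{\mathrm R}(\mathcal H)$ is an isometry $M:\mathcal H\to\mathcal H_A\otimes\mathcal H_B$ for which there are fixed matrices $\tau_A,\tau_B$ with $\mathrm{tr}_B(M\rho M^\dagger)=\tau_A$ and $\mathrm{tr}_A(M\rho M^\dagger)=\tau_B$ for all $\rho\in\mathscr D^{\mathrm R}(\mathcal H)$. It is a real masker if moreover $M\rho M^\dagger\in\mathscr D^{\mathrm R}(\mathcal H_A\otimes\mathcal H_B)$ (reality with respect to the product basis) for all $\rho\in\mathscr D^{\mathrm R}(\mathcal H)$. Its masking spectrum is the multiset of nonzero eigenvalues of $\tau_A$ (equivalently, of $\tau_B$), counted with multiplicity; it is denoted by $\{\lambda_o,m_o\}_o$ with distinct eigenvalues $\lambda_o$ of multiplicity $m_o$, or by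 $\{\mu_l\}_l$ with eigenvalues repeated according to multiplicity. Put $$\kappa(d)=2^{\lfloor (d-1)/2\rfloor},\qquad \kappa^{\mathrm R}(d)=\begin{cases}\kappa(d), & d\equiv 0,1,7 \pmod 8,\\ 2\kappa(d), & d\equiv 2,3,4,5,6 \pmod 8.\end{cases}$$ Let $\{\lambda_o,m_o\}_o$ be a finite family of distinct reals $\lambda_o>0$ and integers $m_o\ge1$ with $\sum_o m_o\lambda_o=1$. 1. If $d\ge 3$, there exist finite-dimensional $\mathcal H_A,\mathcal H_B$ and a complex masker $M:\mathcal H\to\mathcal H_A\otimes\mathcal H_B$ for $\mathscr D^{\mathrm R}(\mathcal H)$ with masking spectrum $\{\lambda_o,m_o\}_o$ if and only if every $m_o$ is divisible by $\kappa(d)$. 2. If $d\ge 2$, there exist finite-dimensional $\mathcal H_A,\mathcal H_B$ and a real masker $M:\mathcal H\to\mathcal H_A\otimes\mathcal H_B$ for $\mathscr D^{\mathrm R}(\mathcal H)$ with masking spectrum $\{\lambda_o,m_o\}_o$ if and only if every $m_o$ is divisible by $\kappa^{\mathrm R}(d)$. 3. Let $d=2$, and let $\{\mu_l\}_l$ be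 a finite family of (not necessarily distinct) positive reals with $\sum_l\mu_l=1$. There exist finite-dimensional $\mathcal H_A,\mathcal H_B$ and a complex masker for $\mathscr D^{\mathrm R}(\mathcal H)$ with masking spectrum $\{\mu_l\}_l$ if and only if there are signs $v_l\in\{1,-1\}$ with $\sum_l v_l\mu_l=0$. -/

import Mathlib

open scoped Matrix ComplexOrder

namespace QMask

/-- Quantum states (density matrices) on the Hilbert space with computational basis `n`. -/
def densityMatrices (n : Type*) [Fintype n] : Set (Matrix n n ℂ) :=
  {ρ | ρ.PosSemidef ∧ ρ.trace = 1}

/-- Real quantum states: density matrices all of whose entries in the computational basis are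
real. -/
def realDensityMatrices (n : Type*) [Fintype n] : Set (Matrix n n ℂ) :=
  {ρ | ρ ∈ densityMatrices n ∧ ∀ i j, (ρ i j).im = 0}

/-- The partial trace over the second factor. -/
def partialTraceB {A B : Type*} [Fintype B] (ρ : Matrix (A × B) (A × B) ℂ) : Matrix A A ℂ :=
  Matrix.of fun i j => ∑ k, ρ (i, k) (j, k)

/-- The partial trace over the first factor. -/
def partialTraceA {A B : Type*} [Fintype A] (ρ : Matrix (A × B) (A × B) ℂ) : Matrix B B ℂ :=
  Matrix.of fun i j => ∑ k, ρ (k, i) (k, j)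

/-- The action `ρ ↦ M ρ M†` on operators. -/
def conjBy {n N : Type*} [Fintype n] (M : Matrix N n ℂ) (ρ : Matrix n n ℂ) : Matrix N N ℂ :=
  M * ρ * Mᴴ

/-- `M` is an isometry from `ℂⁿ` to `ℂᴬ ⊗ ℂᴮ` that masks the set `S` of states, with common
reduced density matrices `τA` and `τB`. -/
structure IsMaskerWith {n A B : Type*} [Fintype n] [DecidableEq n] [Fintype A] [Fintype B]
    (M : Matrix (A × B) n ℂ) (S : Set (Matrix n n ℂ))
    (τA : Matrix A A ℂ) (τB : Matrix B B ℂ) : Prop where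
  isometry : Mᴴ * M = 1
  reducedA : ∀ ρ ∈ S, partialTraceB (conjBy M ρ) = τA
  reducedB : ∀ ρ ∈ S, partialTraceA (conjBy M ρ) = τB

/-- The output of `M` on every state in `S` is a real state. -/
def HasRealOutput {n A B : Type*} [Fintype n] [Fintype A] [Fintype B]
    (M : Matrix (A × B) n ℂ) (S : Set (Matrix n n ℂ)) : Prop :=
  ∀ ρ ∈ S, conjBy M ρ ∈ realDensityMatrices (A × B)

/-- The nonzero eigenvalues of a matrix, with (algebraic) multiplicity. -/
noncomputable def nonzeroSpectrum {n : Type*} [Fintype n] [DecidableEq n]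
    (τ : Matrix n n ℂ) : Multiset ℂ :=
  τ.charpoly.roots.filter (· ≠ 0)

/-- `M` is a masker for `S` with masking spectrum `σ`: the common reduced density matrices have
nonzero spectrum `σ`, a multiset of real numbers. -/
def IsMaskerWithSpectrum {n A B : Type*} [Fintype n] [DecidableEq n]
    [Fintype A] [DecidableEq A] [Fintype B] [DecidableEq B]
    (M : Matrix (A × B) n ℂ) (S : Set (Matrix n n ℂ)) (σ : Multiset ℝ) : Prop :=
  ∃ (τA : Matrix A A ℂ) (τB : Matrix B B ℂ), IsMaskerWith M S τA τB ∧
    nonzeroSpectrum τA = σ.map Complex.ofReal ∧ nonzeroSpectrum τB = σ.map Complex.ofReal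

/-- There is a (complex) masker for the real states in dimension `d`, into some finite-dimensional
bipartite space, with masking spectrum `σ`. -/
def ExistsComplexMasker (d : ℕ) (σ : Multiset ℝ) : Prop :=
  ∃ (a b : ℕ) (M : Matrix (Fin a × Fin b) (Fin d) ℂ),
    IsMaskerWithSpectrum M (realDensityMatrices (Fin d)) σ

/-- There is a real masker for the real states in dimension `d`, into some finite-dimensional
bipartite space, with masking spectrum `σ`. -/
def ExistsRealMasker (d : ℕ) (σ : Multiset ℝ) : Prop :=
  ∃ (a b : ℕ) (M : Matrix (Fin a × Fin b) (Fin d) ℂ),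
    IsMaskerWithSpectrum M (realDensityMatrices (Fin d)) σ ∧
      HasRealOutput M (realDensityMatrices (Fin d))

/-- The spectrum `{λ_o, m_o}_o` of a density matrix (zero eigenvalues omitted): distinct positive
eigenvalues `lam o` with positive multiplicities `m o`, of total weight one. -/
structure IsStateSpectrum {r : ℕ} (lam : Fin r → ℝ) (m : Fin r → ℕ) : Prop where
  injective : Function.Injective lam
  pos : ∀ o, 0 < lam o
  mult_pos : ∀ o, 0 < m o
  sum_eq_one : ∑ o, (m o : ℝ) * lam o = 1

/-- The multiset in which each `lam o` occurs `m o` times. -/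
def spectrumMultiset {r : ℕ} (lam : Fin r → ℝ) (m : Fin r → ℕ) : Multiset ℝ :=
  ∑ o, Multiset.replicate (m o) (lam o)

/-- `κ(d) = 2 ^ ⌊(d - 1) / 2⌋`, used for `d ≥ 2`. -/
def kappa (d : ℕ) : ℕ := 2 ^ ((d - 1) / 2)

/-- `κ^R(d)`: equal to `κ(d)` if `d ≡ 0, 1, 7 (mod 8)` and to `2 κ(d)` otherwise. -/
def kappaR (d : ℕ) : ℕ :=
  if d % 8 = 0 ∨ d % 8 = 1 ∨ d % 8 = 7 then kappa d else 2 * kappa d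

end QMask

/-! Reshape the columns of the isometry into matrices X_0, ..., X_{d-1}, with rows indexed by A and
columns by B. Real states have symmetric coefficient matrices, so masking them means exactly that
X_j X_k† + X_k X_j† vanishes for j ≠ k and equals 2 τ_A for j = k, with the analogous relations for
X_j† X_k and the transpose of τ_B (`isMaskFamily_of_isMaskerWith`, `IsMaskFamily.isMaskerWith`).

Necessity. The products X_j X_0†, j ≥ 1, commute with τ_A, anticommute with each other and square to
-τ_A². On the eigenspace of τ_A for c ≠ 0, dividing by c gives d - 1 anticommuting operators of
square -1, that is, a Clifford representation. Its dimension is the multiplicity of c, hence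
divisible by κ(d) over ℂ and by κ^R(d) over ℝ. A real masker reduces to real matrices because it is
real up to one global phase (`exists_real_of_conjBy_real`).

Sufficiency. Unitary Clifford generators w_j of the minimal size, with the identity as w_0, give X_j
= w_j ⊗ D, where D is diagonal with square-root eigenvalues. These columns are orthonormal if the
w_j with j ≥ 1 are traceless. This is automatic when there are at least two generators or when they
are real and skew. A single complex generator need not be traceless, hence the separate statement
for d = 2: there i X_1 X_0† is Hermitian of trace 0 with square τ_A², so its eigenvalues are signed
eigenvalues of τ_A with sum 0.

Both Clifford inputs (`CliffordDvd`, `CliffordExists`) are proved by hand for p generators of square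
1 and q of square -1. Passing between (p, q) and (p + 1, q + 1) changes the dimension by a factor 2,
and (p + 4, q) can be exchanged for (p, q + 4). Together these yield period 8 in q with factor 16
over ℝ; small cases use determinants and quaternions. -/

namespace QMask

/-- A Clifford system in a ring: pairwise anticommuting elements, those in `P` having square `1`
and those in `Q` having square `-1`. -/
structure IsClifford {R : Type*} [Ring R] (P Q : List R) : Prop where
  pairwise : (P ++ Q).Pairwise fun x y => x * y = -(y * x)
  sq_one : ∀ x ∈ P, x * x = 1
  sq_neg : ∀ x ∈ Q, x * x = -1

namespace IsClifford

/-! ### Clifford relations: twisting by a generator and exchanging four generators -/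

section Ring

variable {R : Type*} [Ring R]

theorem symm_anticomm : Std.Symm fun x y : R => x * y = -(y * x) :=
  ⟨fun x y h => by rw [h, neg_neg]⟩

theorem nil : IsClifford ([] : List R) [] := ⟨by simp, by simp, by simp⟩

theorem of_sublist {P Q P' Q' : List R} (h : IsClifford P Q) (hP : P'.Sublist P)
    (hQ : Q'.Sublist Q) : IsClifford P' Q' :=
  ⟨h.pairwise.sublist (hP.append hQ), fun x hx => h.sq_one x (hP.subset hx),
    fun x hx => h.sq_neg x (hQ.subset hx)⟩

theorem anticomm_of_cons {f : R} {P Q : List R} (h : IsClifford (f :: P) Q) :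
    ∀ x ∈ P ++ Q, x * f = -(f * x) := fun x hx => by
  have := (List.pairwise_cons.1 h.pairwise).1 x hx
  rw [this, neg_neg]

theorem pairwise_cons_iff {f : R} {P Q : List R} :
    (P ++ f :: Q).Pairwise (fun x y => x * y = -(y * x)) ↔
      (f :: (P ++ Q)).Pairwise (fun x y => x * y = -(y * x)) :=
  List.Perm.pairwise_iff (fun h => symm_anticomm.symm _ _ h) List.perm_middle

theorem anticomm_of_cons_right {f : R} {P Q : List R} (h : IsClifford P (f :: Q)) :
    ∀ x ∈ P ++ Q, x * f = -(f * x) := fun x hx => by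
  have := (List.pairwise_cons.1 (pairwise_cons_iff.1 h.pairwise)).1 x hx
  rw [this, neg_neg]

/-- Multiplicativity is asked only on the generators because the intended `φ`, compression to an
eigenspace, is not a ring homomorphism. -/
theorem map_hom {S : Type*} [Ring S] {P Q : List R} (h : IsClifford P Q) (φ : R → S)
    (h1 : φ 1 = 1) (hneg : ∀ x, φ (-x) = -φ x)
    (hmul : ∀ x ∈ P ++ Q, ∀ y ∈ P ++ Q, φ (x * y) = φ x * φ y) :
    IsClifford (P.map φ) (Q.map φ) := by
  refine ⟨?_, ?_, ?_⟩
  · rw [← List.map_append, List.pairwise_map]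
    refine h.pairwise.imp_of_mem ?_
    intro x y hx hy hxy
    rw [← hmul x hx y hy, ← hmul y hy x hx, hxy, hneg]
  · simp only [List.mem_map]
    rintro _ ⟨x, hx, rfl⟩
    have hx' : x ∈ P ++ Q := List.mem_append_left _ hx
    rw [← hmul x hx' x hx', h.sq_one x hx, h1]
  · simp only [List.mem_map]
    rintro _ ⟨x, hx, rfl⟩
    have hx' : x ∈ P ++ Q := List.mem_append_right _ hx
    rw [← hmul x hx' x hx', h.sq_neg x hx, hneg, h1]

theorem mul_left_mul {f x y : R} (hx : x * f = -(f * x)) :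
    (f * x) * (f * y) = -(f * f) * (x * y) := by
  calc (f * x) * (f * y) = f * (x * f) * y := by noncomm_ring
    _ = _ := by rw [hx]; noncomm_ring

/-- Twisting by a generator of square `-1` preserves the squares of the others. -/
theorem twist_neg {P Q : List R} {f : R} (h : IsClifford P (f :: Q)) :
    IsClifford (P.map (f * ·)) (Q.map (f * ·)) := by
  have hf : f * f = -1 := h.sq_neg f (by simp)
  have ha := h.anticomm_of_cons_right
  have hm : ∀ x ∈ P ++ Q, ∀ y, (f * x) * (f * y) = x * y := fun x hx y => by
    rw [mul_left_mul (ha x hx), hf, neg_neg, one_mul]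
  refine ⟨?_, ?_, ?_⟩
  · rw [← List.map_append, List.pairwise_map]
    refine (List.pairwise_cons.1 (pairwise_cons_iff.1 h.pairwise)).2.imp_of_mem ?_
    intro x y hx hy hxy
    rw [hm x hx, hm y hy, hxy]
  · simp only [List.mem_map]
    rintro _ ⟨x, hx, rfl⟩
    rw [hm x (by simp [hx]), h.sq_one x hx]
  · simp only [List.mem_map]
    rintro _ ⟨x, hx, rfl⟩
    rw [hm x (by simp [hx]), h.sq_neg x (by simp [hx])]

/-- Twisting by a generator of square `1` negates the squares of the others. -/
theorem twist_one {P Q : List R} {f : R} (h : IsClifford (f :: P) Q) :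
    IsClifford (Q.map (f * ·)) (P.map (f * ·)) := by
  have hf : f * f = 1 := h.sq_one f (by simp)
  have ha := h.anticomm_of_cons
  have hm : ∀ x ∈ P ++ Q, ∀ y, (f * x) * (f * y) = -(x * y) := fun x hx y => by
    rw [mul_left_mul (ha x hx), hf, neg_mul, one_mul]
  refine ⟨?_, ?_, ?_⟩
  · rw [← List.map_append, List.pairwise_map]
    have h2 : (Q ++ P).Pairwise fun x y => x * y = -(y * x) :=
      (List.Perm.pairwise_iff (fun h => symm_anticomm.symm _ _ h) List.perm_append_comm).1
        (List.pairwise_cons.1 h.pairwise).2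
    refine h2.imp_of_mem ?_
    intro x y hx hy hxy
    rw [hm x (by simpa [or_comm] using hx), hm y (by simpa [or_comm] using hy), hxy]
  · simp only [List.mem_map]
    rintro _ ⟨x, hx, rfl⟩
    rw [hm x (by simp [hx]), h.sq_neg x hx, neg_neg]
  · simp only [List.mem_map]
    rintro _ ⟨x, hx, rfl⟩
    rw [hm x (by simp [hx]), h.sq_one x (by simp [hx])]

/-- The product of four anticommuting elements of equal square `1` or `-1` is an involution that
anticommutes with each of them. -/
theorem quad_relations {a b c d s : R} (hs : s = 1 ∨ s = -1)
    (ha : a * a = s) (hb : b * b = s) (hc : c * c = s) (hd : d * d = s)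
    (hba : b * a = -(a * b)) (hca : c * a = -(a * c)) (hda : d * a = -(a * d))
    (hcb : c * b = -(b * c)) (hdb : d * b = -(b * d)) (hdc : d * c = -(c * d)) :
    let w := a * b * c * d
    w * w = 1 ∧ w * a = -(a * w) ∧ w * b = -(b * w) ∧ w * c = -(c * w) ∧ w * d = -(d * w) := by
  have r : ∀ {x y : R}, x * y = -(y * x) → ∀ t, x * (y * t) = -(y * (x * t)) := by
    intro x y h t; rw [← mul_assoc, h, neg_mul, mul_assoc]
  have q : ∀ {x : R}, x * x = s → ∀ t, x * (x * t) = s * t := by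
    intro x h t; rw [← mul_assoc, h]
  have hba' := r hba
  have hca' := r hca
  have hda' := r hda
  have hcb' := r hcb
  have hdb' := r hdb
  have hdc' := r hdc
  have ha' := q ha
  have hb' := q hb
  have hc' := q hc
  intro w
  rcases hs with rfl | rfl <;>
    simp only [w, mul_assoc, hba', hca', hda, hda', hcb', hdb, hdb', hdc, hdc',
      ha, ha', hb, hb', hc, hc', hd, mul_neg, neg_mul, neg_neg, one_mul, mul_one, and_self]

/-- Moving a further generator past a product of four produces four sign changes, so the product
commutes with it. -/
theorem anticomm_of_pairwise_quad {a b c d : R} {L : List R}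
    (h : (a :: b :: c :: d :: L).Pairwise fun x y => x * y = -(y * x)) :
    (b * a = -(a * b) ∧ c * a = -(a * c) ∧ d * a = -(a * d) ∧
      c * b = -(b * c) ∧ d * b = -(b * d) ∧ d * c = -(c * d)) ∧
    (∀ x ∈ L, (a * b * c * d) * x = x * (a * b * c * d)) ∧
    ∀ y ∈ [a, b, c, d], ∀ x ∈ L, y * x = -(x * y) := by
  simp only [List.pairwise_cons, List.mem_cons] at h
  obtain ⟨h1, h2, h3, h4, -⟩ := h
  refine ⟨?_, ?_, ?_⟩
  · rw [h1 b (by simp), h1 c (by simp), h1 d (by simp), h2 c (by simp), h2 d (by simp),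
      h3 d (by simp)]
    simp
  · intro x hx
    have e1 := h1 x (by simp [hx])
    have e2 := h2 x (by simp [hx])
    have e3 := h3 x (by simp [hx])
    have e4 := h4 x hx
    calc a * b * c * d * x = a * b * c * (d * x) := by noncomm_ring
      _ = -(a * b * (c * x) * d) := by rw [e4]; noncomm_ring
      _ = (a * (b * x) * c * d) := by rw [e3]; noncomm_ring
      _ = -((a * x) * b * c * d) := by rw [e2]; noncomm_ring
      _ = _ := by rw [e1]; noncomm_ring
  · intro y hy x hx
    simp only [List.mem_cons, List.not_mem_nil, or_false] at hy
    rcases hy with rfl | rfl | rfl | rfl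
    · exact h1 x (by simp [hx])
    · exact h2 x (by simp [hx])
    · exact h3 x (by simp [hx])
    · exact h4 x hx

/-- The core of the exchange of four generators of square `s` by four of square `-s`. -/
theorem quad_exchange {a b c d s : R} {L : List R} (hs : s = 1 ∨ s = -1)
    (hsq : ∀ x ∈ [a, b, c, d], x * x = s)
    (h : ([a, b, c, d] ++ L).Pairwise fun x y => x * y = -(y * x)) :
    let w := a * b * c * d
    ([a * w, b * w, c * w, d * w] ++ L).Pairwise (fun x y => x * y = -(y * x)) ∧
      ∀ x ∈ [a * w, b * w, c * w, d * w], x * x = -s := by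
  intro w
  obtain ⟨⟨hba, hca, hda, hcb, hdb, hdc⟩, hw, hL⟩ := anticomm_of_pairwise_quad h
  obtain ⟨ww, wa, wb, wc, wd⟩ := quad_relations hs (hsq a (by simp)) (hsq b (by simp))
    (hsq c (by simp)) (hsq d (by simp)) hba hca hda hcb hdb hdc
  change w * w = 1 at ww
  change w * a = -(a * w) at wa
  change w * b = -(b * w) at wb
  change w * c = -(c * w) at wc
  change w * d = -(d * w) at wd
  -- Since w² = 1 and w anticommutes with the four generators, multiplying them by w flips their
  -- squares and keeps their anticommutation.
  have hm : ∀ x y, w * y = -(y * w) → (x * w) * (y * w) = -(x * y) := fun x y hy => by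
    calc (x * w) * (y * w) = x * (w * y) * w := by noncomm_ring
      _ = -(x * y * (w * w)) := by rw [hy]; noncomm_ring
      _ = _ := by rw [ww, mul_one]
  have hx : ∀ y ∈ [a, b, c, d], ∀ x ∈ L, (y * w) * x = -(x * (y * w)) := fun y hy x hx => by
    rw [mul_assoc, hw x hx, ← mul_assoc, hL y hy x hx, neg_mul, mul_assoc]
  have hLL : L.Pairwise fun x y => x * y = -(y * x) := (List.pairwise_append.1 h).2.1
  refine ⟨?_, ?_⟩
  · refine List.pairwise_append.2 ⟨?_, hLL, ?_⟩
    · simp [hm, wa, wb, wc, wd, hba, hca, hda, hcb, hdb, hdc]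
    · intro x hx' y hy
      simp only [List.mem_cons, List.not_mem_nil, or_false] at hx'
      rcases hx' with rfl | rfl | rfl | rfl
      · exact hx a (by simp) y hy
      · exact hx b (by simp) y hy
      · exact hx c (by simp) y hy
      · exact hx d (by simp) y hy
  · have := hsq
    simp only [List.mem_cons, List.not_mem_nil, or_false, forall_eq_or_imp, forall_eq] at this ⊢
    simp [hm, wa, wb, wc, wd, this]

theorem exchange_neg {a b c d : R} {P Q : List R} (h : IsClifford P ([a, b, c, d] ++ Q)) :
    let w := a * b * c * d
    IsClifford ([a * w, b * w, c * w, d * w] ++ P) Q := by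
  intro w
  have hp : ([a, b, c, d] ++ (P ++ Q)).Pairwise fun x y => x * y = -(y * x) := by
    refine (List.Perm.pairwise_iff (fun h => symm_anticomm.symm _ _ h) ?_).1 h.pairwise
    rw [← List.append_assoc, ← List.append_assoc]
    exact List.perm_append_comm.append_right Q
  obtain ⟨h1, h2⟩ := quad_exchange (Or.inr rfl)
    (fun x hx => h.sq_neg x (List.mem_append_left _ hx)) hp
  rw [neg_neg] at h2
  refine ⟨by rw [List.append_assoc]; exact h1, fun x hx => ?_,
    fun x hx => h.sq_neg x (by simp [hx])⟩
  rcases List.mem_append.1 hx with hx | hx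
  · exact h2 x hx
  · exact h.sq_one x hx

theorem exchange_one {a b c d : R} {P Q : List R} (h : IsClifford ([a, b, c, d] ++ P) Q) :
    let w := a * b * c * d
    IsClifford P ([a * w, b * w, c * w, d * w] ++ Q) := by
  intro w
  obtain ⟨h1, h2⟩ := quad_exchange (L := P ++ Q) (Or.inl rfl)
    (fun x hx => h.sq_one x (List.mem_append_left _ hx)) (by simpa using h.pairwise)
  refine ⟨?_, fun x hx => h.sq_one x (by simp [hx]), fun x hx => ?_⟩
  · refine (List.Perm.pairwise_iff (fun h => symm_anticomm.symm _ _ h) ?_).1 h1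
    rw [← List.append_assoc, ← List.append_assoc]
    exact List.perm_append_comm.append_right Q
  · rcases List.mem_append.1 hx with hx | hx
    · exact h2 x hx
    · exact h.sq_neg x hx

end Ring

/-! ### Compression to the fixed space of an involution -/

section Halving

variable {K V : Type*} [Field K] [CharZero K] [AddCommGroup V] [Module K V]

/-- The spectral projection of an involution `a`, onto its fixed space. -/
noncomputable def fixedProj (a : Module.End K V) (ha : a * a = 1) :
    V →ₗ[K] a.eigenspace 1 :=
  LinearMap.codRestrict _ ((2 : K)⁻¹ • (1 + a)) fun v => by
    have h : a (a v) = v := by rw [← Module.End.mul_apply, ha, Module.End.one_apply]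
    simp [h, add_comm]

/-- The compression of an endomorphism to the fixed space of an involution. -/
noncomputable def compress (a : Module.End K V) (ha : a * a = 1) (x : Module.End K V) :
    Module.End K (a.eigenspace 1) :=
  fixedProj a ha ∘ₗ x ∘ₗ (a.eigenspace 1).subtype

theorem fixedProj_coe {a : Module.End K V} (ha : a * a = 1) (v : a.eigenspace 1) :
    fixedProj a ha v = v := by
  have hv : a v = (v : V) := by simpa using Module.End.mem_eigenspace_iff.1 v.2
  ext
  simp only [fixedProj, LinearMap.codRestrict_apply, LinearMap.smul_apply, LinearMap.add_apply,
    Module.End.one_apply, hv, ← two_smul K (v : V), smul_smul]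
  simp

/-- An operator commuting with `a` preserves the fixed space, so the projection in `compress` does
nothing there. The projection only serves to define `compress` on all operators, so that it can be
mapped over lists. -/
theorem coe_compress_apply {a x : Module.End K V} (ha : a * a = 1) (hx : x * a = a * x)
    (v : a.eigenspace 1) : (compress a ha x v : V) = x v := by
  have hv : a v = (v : V) := by simpa using Module.End.mem_eigenspace_iff.1 v.2
  have hxv : x v ∈ a.eigenspace 1 := by
    rw [Module.End.mem_eigenspace_iff, one_smul, ← Module.End.mul_apply, ← hx,
      Module.End.mul_apply, hv]
  exact congrArg Subtype.val (fixedProj_coe ha ⟨x v, hxv⟩)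

theorem isClifford_compress {a : Module.End K V} (ha : a * a = 1) {P Q : List (Module.End K V)}
    (h : IsClifford P Q) (hc : ∀ x ∈ P ++ Q, x * a = a * x) :
    IsClifford (P.map (compress a ha)) (Q.map (compress a ha)) := by
  refine h.map_hom _ ?_ ?_ ?_
  · ext v
    rw [coe_compress_apply ha (by simp)]
    simp
  · intro x
    simp [compress]
  · intro x hx y hy
    have hxy : (x * y) * a = a * (x * y) := by
      rw [mul_assoc, hc y hy, ← mul_assoc, hc x hx, mul_assoc]
    ext v
    rw [coe_compress_apply ha hxy, Module.End.mul_apply, Module.End.mul_apply,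
      coe_compress_apply ha (hc x hx), coe_compress_apply ha (hc y hy)]

/-- The injective operator `f` anticommutes with `a`, hence interchanges its eigenspaces for 1 and
-1, which together span `V`. -/
theorem two_mul_finrank_eigenspace [FiniteDimensional K V] {a f : Module.End K V} (ha : a * a = 1)
    (hf : f * f = 1 ∨ f * f = -1) (haf : a * f = -(f * a)) :
    Module.finrank K V = 2 * Module.finrank K (a.eigenspace 1) := by
  have hinj : Function.Injective f := by
    intro v w hvw
    have : (f * f) v = (f * f) w := by simp [Module.End.mul_apply, hvw]
    rcases hf with hf | hf <;> simpa [hf] using this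
  have haf' : ∀ v, a (f v) = -(f (a v)) := fun v => by
    rw [← Module.End.mul_apply, haf]; rfl
  have h1 : (a.eigenspace 1).map f ≤ a.eigenspace (-1) := by
    rintro _ ⟨v, hv, rfl⟩
    have hv : a v = v := by simpa using Module.End.mem_eigenspace_iff.1 hv
    rw [Module.End.mem_eigenspace_iff, haf', hv]; simp
  have h2 : (a.eigenspace (-1)).map f ≤ a.eigenspace 1 := by
    rintro _ ⟨v, hv, rfl⟩
    have hv : a v = -v := by simpa using Module.End.mem_eigenspace_iff.1 hv
    rw [Module.End.mem_eigenspace_iff, haf', hv]; simp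
  have e1 : Module.finrank K (a.eigenspace 1) = Module.finrank K (a.eigenspace (-1)) :=
    le_antisymm
      ((LinearEquiv.finrank_eq (Submodule.equivMapOfInjective f hinj _)).trans_le
        (Submodule.finrank_mono h1))
      ((LinearEquiv.finrank_eq (Submodule.equivMapOfInjective f hinj _)).trans_le
        (Submodule.finrank_mono h2))
  have hc : IsCompl (a.eigenspace 1) (a.eigenspace (-1)) := by
    constructor
    · rw [Submodule.disjoint_def]
      intro v hv hv'
      rw [Module.End.mem_eigenspace_iff] at hv hv'
      rw [hv, one_smul, neg_smul, one_smul] at hv'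
      have h2 : (2 : K) • v = 0 := by rw [two_smul, ← sub_neg_eq_add, ← hv', sub_self]
      exact (smul_eq_zero.1 h2).resolve_left two_ne_zero
    · rw [codisjoint_iff_le_sup]
      intro v _
      have haa : a (a v) = v := by rw [← Module.End.mul_apply, ha, Module.End.one_apply]
      have : v = (2 : K)⁻¹ • (v + a v) + (2 : K)⁻¹ • (v - a v) := by
        rw [← smul_add, add_add_sub_cancel, ← two_smul K v, smul_smul]
        simp
      rw [this]
      refine Submodule.add_mem_sup ?_ ?_ <;> rw [Module.End.mem_eigenspace_iff] <;>
        simp [haa, add_comm]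
      rw [← smul_neg, neg_sub]
  rw [← Submodule.finrank_add_eq_of_isCompl hc, ← e1, two_mul]

end Halving

end IsClifford

/-- Every finite-dimensional representation of a Clifford system with `p` generators of square `1`
and `q` generators of square `-1` over `K` has dimension divisible by `N`. -/
def CliffordDvd (K : Type) [Field K] (N p q : ℕ) : Prop :=
  ∀ (V : Type) [AddCommGroup V] [Module K V] [FiniteDimensional K V]
    (P Q : List (Module.End K V)), IsClifford P Q → P.length = p → Q.length = q →
      N ∣ Module.finrank K V

/-! ### Divisibility of dimensions of Clifford representations -/

namespace CliffordDvd

variable {K : Type} [Field K] {N p q : ℕ}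

theorem one : CliffordDvd K 1 p q := fun _ _ _ _ _ _ _ _ _ => one_dvd _

theorem succ_right (h : CliffordDvd K N p q) : CliffordDvd K N p (q + 1) := by
  intro V _ _ _ P Q hPQ hp hq
  refine h V P (Q.drop 1) (hPQ.of_sublist (List.Sublist.refl _) (List.drop_sublist _ _)) hp ?_
  simp [hq]

/-- Split off `a` of square 1 and `f` of square -1. For each remaining generator x, the product f x
commutes with `a` and has the square of x, so these act on the fixed space of `a`, of half the
dimension. -/
theorem succ_succ [CharZero K] (h : CliffordDvd K N p q) :
    CliffordDvd K (2 * N) (p + 1) (q + 1) := by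
  intro V _ _ _ P Q hPQ hp hq
  obtain ⟨a, P, rfl⟩ := List.exists_cons_of_length_eq_add_one hp
  obtain ⟨f, Q, rfl⟩ := List.exists_cons_of_length_eq_add_one hq
  have ha : a * a = 1 := hPQ.sq_one a (by simp)
  have hac := hPQ.anticomm_of_cons
  have hf : f * f = -1 := hPQ.sq_neg f (by simp)
  have hfa := hac f (by simp)
  have ht := (hPQ.of_sublist (List.sublist_cons_self a P) (List.Sublist.refl _)).twist_neg
  have hc := IsClifford.isClifford_compress ha ht (by
    intro x hx
    rw [← List.map_append, List.mem_map] at hx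
    obtain ⟨x, hx, rfl⟩ := hx
    have hxa := hac x (by simpa [or_left_comm] using Or.inr (List.mem_append.1 hx))
    rw [mul_assoc, hxa, mul_neg, ← mul_assoc, hfa, neg_mul, neg_neg, mul_assoc])
  rw [IsClifford.two_mul_finrank_eigenspace ha (Or.inr hf) (by rw [hfa, neg_neg])]
  exact Nat.mul_dvd_mul_left 2 (h _ _ _ hc (by simpa using hp) (by simpa using hq))

/-- As in `succ_succ`, but with f² = 1: twisting by `f` now negates squares, so `p` and `q` trade
places in the hypothesis. -/
theorem add_two [CharZero K] (h : CliffordDvd K N q p) : CliffordDvd K (2 * N) (p + 2) q := by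
  intro V _ _ _ P Q hPQ hp hq
  obtain ⟨a, P, rfl⟩ := List.exists_cons_of_length_eq_add_one hp
  obtain ⟨f, P, rfl⟩ := List.exists_cons_of_length_eq_add_one (Nat.succ.inj hp)
  have ha : a * a = 1 := hPQ.sq_one a (by simp)
  have hac := hPQ.anticomm_of_cons
  have hf : f * f = 1 := hPQ.sq_one f (by simp)
  have hfa := hac f (by simp)
  have ht := (hPQ.of_sublist (List.sublist_cons_self a _) (List.Sublist.refl _)).twist_one
  have hc := IsClifford.isClifford_compress ha ht (by
    intro x hx
    rw [← List.map_append, List.mem_map] at hx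
    obtain ⟨x, hx, rfl⟩ := hx
    have hxa := hac x (by simpa using Or.inr (List.mem_append.1 hx).symm)
    rw [mul_assoc, hxa, mul_neg, ← mul_assoc, hfa, neg_mul, neg_neg, mul_assoc])
  rw [IsClifford.two_mul_finrank_eigenspace ha (Or.inl hf) (by rw [hfa, neg_neg])]
  exact Nat.mul_dvd_mul_left 2 (h _ _ _ hc (by simpa using hq) (by simpa using hp))

theorem exchange (h : CliffordDvd K N (p + 4) q) : CliffordDvd K N p (q + 4) := by
  intro V _ _ _ P Q hPQ hp hq
  obtain ⟨a, Q, rfl⟩ := List.exists_cons_of_length_eq_add_one hq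
  obtain ⟨b, Q, rfl⟩ := List.exists_cons_of_length_eq_add_one (Nat.succ.inj hq)
  obtain ⟨c, Q, rfl⟩ := List.exists_cons_of_length_eq_add_one (Nat.succ.inj (Nat.succ.inj hq))
  obtain ⟨d, Q, rfl⟩ := List.exists_cons_of_length_eq_add_one
    (Nat.succ.inj (Nat.succ.inj (Nat.succ.inj hq)))
  refine h V _ _ (IsClifford.exchange_neg hPQ) ?_ (by simpa using hq)
  simp only [List.length_append, List.length_cons, List.length_nil, hp]
  omega

/-- Over `ℂ`, the sign of the square of a generator is immaterial. -/
theorem complex_succ (h : CliffordDvd ℂ N (p + 1) q) : CliffordDvd ℂ N p (q + 1) := by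
  intro V _ _ _ P Q hPQ hp hq
  obtain ⟨f, Q, rfl⟩ := List.exists_cons_of_length_eq_add_one hq
  have hf : f * f = -1 := hPQ.sq_neg f (by simp)
  obtain ⟨hfx, hpw⟩ := List.pairwise_cons.1 (IsClifford.pairwise_cons_iff.1 hPQ.pairwise)
  refine h V ((Complex.I • f) :: P) Q ⟨?_, ?_, fun x hx => hPQ.sq_neg x (by simp [hx])⟩
    (by simpa using hp) (by simpa using hq)
  · refine List.pairwise_cons.2 ⟨fun x hx => ?_, hpw⟩
    rw [smul_mul_assoc, mul_smul_comm, hfx x hx, smul_neg]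
  · intro x hx
    rcases List.mem_cons.1 hx with rfl | hx
    · rw [smul_mul_smul_comm, hf]; simp
    · exact hPQ.sq_one x hx

theorem real_zero_one : CliffordDvd ℝ 2 0 1 := by
  intro V _ _ _ P Q hPQ hp hq
  obtain ⟨f, Q, rfl⟩ := List.exists_cons_of_length_eq_add_one hq
  have hf : f * f = -1 := hPQ.sq_neg f (by simp)
  -- The determinant gives det(f)² = (-1)^dim, which excludes odd dimension.
  have h := congrArg LinearMap.det hf
  rw [map_mul, ← neg_one_smul ℝ (1 : Module.End ℝ V), LinearMap.det_smul, map_one, mul_one] at h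
  rw [← even_iff_two_dvd]
  by_contra hodd
  rw [Nat.not_even_iff_odd] at hodd
  rw [hodd.neg_one_pow] at h
  nlinarith [mul_self_nonneg (LinearMap.det f)]

theorem real_zero_two : CliffordDvd ℝ 4 0 2 := by
  intro V _ _ _ P Q hPQ hp hq
  obtain ⟨f, Q, rfl⟩ := List.exists_cons_of_length_eq_add_one hq
  obtain ⟨g, Q, rfl⟩ := List.exists_cons_of_length_eq_add_one (Nat.succ.inj hq)
  have hf : f * f = -1 := hPQ.sq_neg f (by simp)
  have hg : g * g = -1 := hPQ.sq_neg g (by simp)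
  have hgf := hPQ.anticomm_of_cons_right g (by simp)
  -- Two anticommuting operators of square -1 make `V` a vector space over the quaternions, so its
  -- real dimension is a multiple of 4.
  let b : QuaternionAlgebra.Basis (Module.End ℝ V) (-1 : ℝ) 0 (-1) :=
    { i := f, j := g, k := f * g
      i_mul_i := by simp [hf]
      j_mul_j := by simp [hg]
      i_mul_j := rfl
      j_mul_i := by simp [hgf] }
  let _ : Module (Quaternion ℝ) V := Module.compHom V b.liftHom.toRingHom
  have : IsScalarTower ℝ (Quaternion ℝ) V := ⟨fun r x v =>
    LinearMap.congr_fun (b.lift_smul r x) v⟩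
  have := Module.finrank_mul_finrank ℝ (Quaternion ℝ) V
  rw [Quaternion.finrank_eq_four] at this
  exact ⟨_, this.symm⟩

theorem complex (n : ℕ) : CliffordDvd ℂ (2 ^ (n / 2)) 0 n := by
  induction n using Nat.strong_induction_on with
  | _ n ih =>
    match n with
    | 0 => exact one
    | 1 => exact one
    | n + 2 =>
      rw [show (n + 2) / 2 = n / 2 + 1 by omega, pow_succ']
      exact (ih n (by omega)).succ_succ.complex_succ

/-- The types run (0, q), (4, q + 4), (0, q + 8): four doublings, then one exchange. -/
theorem real_add_eight (h : CliffordDvd ℝ N 0 q) : CliffordDvd ℝ (16 * N) 0 (q + 8) := by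
  have := h.succ_succ.succ_succ.succ_succ.succ_succ.exchange
  rwa [show 2 * (2 * (2 * (2 * N))) = 16 * N by ring] at this

theorem real_zero_four : CliffordDvd ℝ 8 0 4 := real_zero_two.add_two.exchange

end CliffordDvd

theorem kappa_add_eight (n : ℕ) : kappa (n + 8 + 1) = 16 * kappa (n + 1) := by
  simp only [kappa]
  rw [show (n + 8 + 1 - 1) / 2 = (n + 1 - 1) / 2 + 4 by omega, pow_add]
  ring

theorem kappaR_add_eight (n : ℕ) : kappaR (n + 8 + 1) = 16 * kappaR (n + 1) := by
  simp only [kappaR, kappa_add_eight]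
  rw [show (n + 8 + 1) % 8 = (n + 1) % 8 by omega]
  split_ifs <;> ring

/-- For n = 0, ..., 7 the values are 1, 2, 4, 4, 8, 8, 8, 8. Where the value does not grow, the
bound is inherited by forgetting a generator. -/
theorem CliffordDvd.real (n : ℕ) : CliffordDvd ℝ (kappaR (n + 1)) 0 n := by
  induction n using Nat.strong_induction_on with
  | _ n ih =>
    match n with
    | 0 => exact one
    | 1 => exact real_zero_one
    | 2 => exact real_zero_two
    | 3 => exact real_zero_two.succ_right
    | 4 => exact real_zero_four
    | 5 => exact real_zero_four.succ_right
    | 6 => exact real_zero_four.succ_right.succ_right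
    | 7 => exact real_zero_four.succ_right.succ_right.succ_right
    | n + 8 => rw [kappaR_add_eight]; exact (ih n (by omega)).real_add_eight

/-! ### Kronecker products and real 2 × 2 generators -/

section Kronecker

open scoped Kronecker

variable {K : Type*} [CommRing K] {I J : Type*} [Fintype I] [Fintype J]

theorem neg_kronecker {I J : Type*} (x : Matrix I I K) (y : Matrix J J K) :
    (-x) ⊗ₖ y = -(x ⊗ₖ y) := by
  ext; simp

theorem kronecker_neg {I J : Type*} (x : Matrix I I K) (y : Matrix J J K) :
    x ⊗ₖ (-y) = -(x ⊗ₖ y) := by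
  ext; simp

theorem pairwise_map_kronecker {L : List (Matrix I I K)}
    (h : L.Pairwise fun x y => x * y = -(y * x)) (D : Matrix J J K) :
    (L.map (· ⊗ₖ D)).Pairwise fun x y => x * y = -(y * x) := by
  rw [List.pairwise_map]
  refine h.imp fun {x y} hxy => ?_
  rw [← Matrix.mul_kronecker_mul, ← Matrix.mul_kronecker_mul, hxy, neg_kronecker]

theorem one_kronecker_anticomm [DecidableEq I] {x : Matrix I I K} {D E : Matrix J J K}
    (h : E * D = -(D * E)) :
    ((1 : Matrix I I K) ⊗ₖ E) * (x ⊗ₖ D) = -((x ⊗ₖ D) * ((1 : Matrix I I K) ⊗ₖ E)) := by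
  rw [← Matrix.mul_kronecker_mul, ← Matrix.mul_kronecker_mul, h, one_mul, mul_one,
    kronecker_neg]

theorem kronecker_mul_self {x : Matrix I I K} {D : Matrix J J K} :
    (x ⊗ₖ D) * (x ⊗ₖ D) = (x * x) ⊗ₖ (D * D) := (Matrix.mul_kronecker_mul ..).symm

end Kronecker

section Pauli

variable (K : Type*) [CommRing K]

/-- The real Pauli matrix `X`. -/
def pauliX : Matrix (Fin 2) (Fin 2) K := !![0, 1; 1, 0]

/-- The real Pauli matrix `Z`. -/
def pauliZ : Matrix (Fin 2) (Fin 2) K := !![1, 0; 0, -1]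

/-- The real matrix of a quarter turn. -/
def quarterTurn : Matrix (Fin 2) (Fin 2) K := !![0, 1; -1, 0]

theorem pauliX_sq : pauliX K * pauliX K = 1 := by
  simp [pauliX, Matrix.one_fin_two]

theorem pauliZ_sq : pauliZ K * pauliZ K = 1 := by
  simp [pauliZ, Matrix.one_fin_two]

theorem quarterTurn_sq : quarterTurn K * quarterTurn K = -1 := by
  ext i j; fin_cases i <;> fin_cases j <;> simp [quarterTurn]

theorem pauliX_mul_pauliZ : pauliX K * pauliZ K = -(pauliZ K * pauliX K) := by
  simp [pauliX, pauliZ]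

theorem pauliX_mul_quarterTurn : pauliX K * quarterTurn K = -(quarterTurn K * pauliX K) := by
  simp [pauliX, quarterTurn]

theorem quarterTurn_mul_pauliZ : quarterTurn K * pauliZ K = -(pauliZ K * quarterTurn K) := by
  simp [pauliZ, quarterTurn]

variable [StarRing K]

theorem pauliX_unitary : (pauliX K)ᴴ * pauliX K = 1 := by
  ext i j; fin_cases i <;> fin_cases j <;> simp [pauliX, Matrix.mul_apply]

theorem pauliZ_unitary : (pauliZ K)ᴴ * pauliZ K = 1 := by
  ext i j; fin_cases i <;> fin_cases j <;> simp [pauliZ, Matrix.mul_apply]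

theorem quarterTurn_unitary : (quarterTurn K)ᴴ * quarterTurn K = 1 := by
  ext i j; fin_cases i <;> fin_cases j <;> simp [quarterTurn, Matrix.mul_apply]

end Pauli

/-- There is a Clifford system of unitary `N × N` matrices over `K`, with `p` generators of square
`1` and `q` generators of square `-1`. -/
def CliffordExists (K : Type) [Field K] [StarRing K] (N p q : ℕ) : Prop :=
  ∃ (I : Type) (_ : Fintype I) (_ : DecidableEq I) (P Q : List (Matrix I I K)),
    Fintype.card I = N ∧ IsClifford P Q ∧ (∀ x ∈ P ++ Q, xᴴ * x = 1) ∧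
      P.length = p ∧ Q.length = q

/-! ### Unitary Clifford systems of minimal size -/

namespace CliffordExists

open scoped Kronecker

variable {K : Type} [Field K] [StarRing K] {N p q : ℕ}

theorem kronecker_unitary {I J : Type*} [Fintype I] [DecidableEq I] [Fintype J] [DecidableEq J]
    {x : Matrix I I K} {y : Matrix J J K} (hx : xᴴ * x = 1) (hy : yᴴ * y = 1) :
    (x ⊗ₖ y)ᴴ * (x ⊗ₖ y) = 1 := by
  rw [Matrix.conjTranspose_kronecker, ← Matrix.mul_kronecker_mul, hx, hy, Matrix.one_kronecker_one]

theorem mul_unitary {I : Type*} [Fintype I] [DecidableEq I]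
    {x y : Matrix I I K} (hx : xᴴ * x = 1) (hy : yᴴ * y = 1) : (x * y)ᴴ * (x * y) = 1 := by
  rw [Matrix.conjTranspose_mul, Matrix.mul_assoc, ← Matrix.mul_assoc xᴴ, hx, Matrix.one_mul, hy]

theorem zero : CliffordExists K 1 0 0 :=
  ⟨Unit, inferInstance, inferInstance, [], [], by simp, IsClifford.nil, by simp, rfl, rfl⟩

theorem one_zero : CliffordExists K 1 1 0 :=
  ⟨Unit, inferInstance, inferInstance, [1], [], by simp, ⟨by simp, by simp, by simp⟩, by simp,
    rfl, rfl⟩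

theorem pred_left (h : CliffordExists K N (p + 1) q) : CliffordExists K N p q := by
  obtain ⟨I, _, _, P, Q, hN, hPQ, hU, hp, hq⟩ := h
  refine ⟨I, _, _, P.drop 1, Q, hN,
    hPQ.of_sublist (List.drop_sublist _ _) (List.Sublist.refl _), fun x hx => hU x ?_, by simp [hp],
    hq⟩
  exact ((List.drop_sublist 1 P).append_right Q).subset hx

theorem pred_right (h : CliffordExists K N p (q + 1)) : CliffordExists K N p q := by
  obtain ⟨I, _, _, P, Q, hN, hPQ, hU, hp, hq⟩ := h
  refine ⟨I, _, _, P, Q.drop 1, hN,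
    hPQ.of_sublist (List.Sublist.refl _) (List.drop_sublist _ _), fun x hx => hU x ?_, hp,
    by simp [hq]⟩
  exact ((List.drop_sublist 1 Q).append_left P).subset hx

theorem succ_succ (h : CliffordExists K N p q) : CliffordExists K (2 * N) (p + 1) (q + 1) := by
  obtain ⟨I, _, _, P, Q, hN, hPQ, hU, hp, hq⟩ := h
  -- Z² = 1 keeps the squares of the old generators, while X and the quarter turn anticommute with Z
  -- and with each other and supply the two new ones.
  refine ⟨I × Fin 2, inferInstance, inferInstance, (1 ⊗ₖ pauliX K) :: P.map (· ⊗ₖ pauliZ K),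
    (1 ⊗ₖ quarterTurn K) :: Q.map (· ⊗ₖ pauliZ K), by simp [hN, mul_comm], ⟨?_, ?_, ?_⟩, ?_,
    by simp [hp], by simp [hq]⟩
  · have hL := pairwise_map_kronecker hPQ.pairwise (pauliZ K)
    rw [List.map_append] at hL
    rw [List.cons_append, List.pairwise_cons, IsClifford.pairwise_cons_iff, List.pairwise_cons]
    refine ⟨fun x hx => ?_, fun x hx => ?_, hL⟩
    · rcases List.mem_append.1 hx with hx | hx
      · obtain ⟨x, -, rfl⟩ := List.mem_map.1 hx
        exact one_kronecker_anticomm (pauliX_mul_pauliZ K)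
      · rcases List.mem_cons.1 hx with rfl | hx
        · exact one_kronecker_anticomm (pauliX_mul_quarterTurn K)
        · obtain ⟨x, -, rfl⟩ := List.mem_map.1 hx
          exact one_kronecker_anticomm (pauliX_mul_pauliZ K)
    · rw [← List.map_append] at hx
      obtain ⟨x, -, rfl⟩ := List.mem_map.1 hx
      exact one_kronecker_anticomm (quarterTurn_mul_pauliZ K)
  · intro x hx
    rcases List.mem_cons.1 hx with rfl | hx
    · rw [kronecker_mul_self, pauliX_sq, one_mul, Matrix.one_kronecker_one]
    · obtain ⟨x, hxm, rfl⟩ := List.mem_map.1 hx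
      rw [kronecker_mul_self, pauliZ_sq, hPQ.sq_one x hxm, Matrix.one_kronecker_one]
  · intro x hx
    rcases List.mem_cons.1 hx with rfl | hx
    · rw [kronecker_mul_self, quarterTurn_sq, one_mul, kronecker_neg,
        Matrix.one_kronecker_one]
    · obtain ⟨x, hxm, rfl⟩ := List.mem_map.1 hx
      rw [kronecker_mul_self, pauliZ_sq, hPQ.sq_neg x hxm, neg_kronecker,
        Matrix.one_kronecker_one]
  · intro x hx
    simp only [List.mem_append, List.mem_cons, List.mem_map] at hx
    rcases hx with (rfl | ⟨x, hx, rfl⟩) | (rfl | ⟨x, hx, rfl⟩)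
    · exact kronecker_unitary (by simp) (pauliX_unitary K)
    · exact kronecker_unitary (hU x (by simp [hx])) (pauliZ_unitary K)
    · exact kronecker_unitary (by simp) (quarterTurn_unitary K)
    · exact kronecker_unitary (hU x (by simp [hx])) (pauliZ_unitary K)

/-- Doubling the dimension turns all generators into generators of square `-1`. -/
theorem all_neg (h : CliffordExists K N p q) : CliffordExists K (2 * N) 0 (p + q) := by
  obtain ⟨I, _, _, P, Q, hN, hPQ, hU, hp, hq⟩ := h
  -- The quarter turn has square -1 and commutes with itself and with 1: it flips squares and leaves
  -- anticommutation to the first factor.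
  refine ⟨I × Fin 2, inferInstance, inferInstance, [],
    P.map (· ⊗ₖ quarterTurn K) ++ Q.map (· ⊗ₖ 1), by simp [hN, mul_comm], ⟨?_, by simp, ?_⟩, ?_,
    rfl, by simp [hp, hq]⟩
  · obtain ⟨h1, h2, h3⟩ := List.pairwise_append.1 hPQ.pairwise
    rw [List.nil_append, List.pairwise_append]
    refine ⟨pairwise_map_kronecker h1 _, pairwise_map_kronecker h2 _, ?_⟩
    intro x hx y hy
    obtain ⟨x, hxm, rfl⟩ := List.mem_map.1 hx
    obtain ⟨y, hym, rfl⟩ := List.mem_map.1 hy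
    rw [← Matrix.mul_kronecker_mul, ← Matrix.mul_kronecker_mul, h3 x hxm y hym,
      neg_kronecker, one_mul, mul_one]
  · intro x hx
    rcases List.mem_append.1 hx with hx | hx
    · obtain ⟨x, hxm, rfl⟩ := List.mem_map.1 hx
      rw [kronecker_mul_self, quarterTurn_sq, hPQ.sq_one x hxm, kronecker_neg,
        Matrix.one_kronecker_one]
    · obtain ⟨x, hxm, rfl⟩ := List.mem_map.1 hx
      rw [kronecker_mul_self, one_mul, hPQ.sq_neg x hxm, neg_kronecker,
        Matrix.one_kronecker_one]
  · intro x hx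
    simp only [List.mem_append, List.mem_map, List.not_mem_nil, false_or] at hx
    rcases hx with ⟨x, hx, rfl⟩ | ⟨x, hx, rfl⟩
    · exact kronecker_unitary (hU x (by simp [hx])) (quarterTurn_unitary K)
    · exact kronecker_unitary (hU x (by simp [hx])) (by simp)

theorem exchange (h : CliffordExists K N (p + 4) q) : CliffordExists K N p (q + 4) := by
  obtain ⟨I, _, _, P, Q, hN, hPQ, hU, hp, hq⟩ := h
  obtain ⟨a, P, rfl⟩ := List.exists_cons_of_length_eq_add_one hp
  obtain ⟨b, P, rfl⟩ := List.exists_cons_of_length_eq_add_one (Nat.succ.inj hp)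
  obtain ⟨c, P, rfl⟩ := List.exists_cons_of_length_eq_add_one (Nat.succ.inj (Nat.succ.inj hp))
  obtain ⟨d, P, rfl⟩ := List.exists_cons_of_length_eq_add_one
    (Nat.succ.inj (Nat.succ.inj (Nat.succ.inj hp)))
  have ha := hU a (by simp)
  have hb := hU b (by simp)
  have hc := hU c (by simp)
  have hd := hU d (by simp)
  have hw := mul_unitary (mul_unitary (mul_unitary ha hb) hc) hd
  refine ⟨I, _, _, _, _, hN, IsClifford.exchange_one hPQ, ?_, by simpa using hp, ?_⟩
  · intro x hx
    simp only [List.mem_append, List.mem_cons, List.not_mem_nil, or_false] at hx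
    rcases hx with hx | (rfl | rfl | rfl | rfl) | hx
    · exact hU x (by simp [hx])
    · exact mul_unitary ha hw
    · exact mul_unitary hb hw
    · exact mul_unitary hc hw
    · exact mul_unitary hd hw
    · exact hU x (by simp [hx])
  · simp only [List.length_append, List.length_cons, List.length_nil, hq]
    omega

theorem complex_succ (h : CliffordExists ℂ N (p + 1) q) : CliffordExists ℂ N p (q + 1) := by
  obtain ⟨I, _, _, P, Q, hN, hPQ, hU, hp, hq⟩ := h
  obtain ⟨f, P, rfl⟩ := List.exists_cons_of_length_eq_add_one hp
  obtain ⟨hfx, hpw⟩ := List.pairwise_cons.1 hPQ.pairwise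
  have hf : f * f = 1 := hPQ.sq_one f (by simp)
  refine ⟨I, _, _, P, (Complex.I • f) :: Q, hN,
    ⟨?_, fun x hx => hPQ.sq_one x (by simp [hx]), ?_⟩, ?_, by simpa using hp, by simp [hq]⟩
  · rw [IsClifford.pairwise_cons_iff]
    refine List.pairwise_cons.2 ⟨fun x hx => ?_, hpw⟩
    rw [smul_mul_assoc, mul_smul_comm, hfx x hx, smul_neg]
  · intro x hx
    rcases List.mem_cons.1 hx with rfl | hx
    · rw [smul_mul_smul_comm, hf]; simp
    · exact hPQ.sq_neg x hx
  · intro x hx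
    simp only [List.mem_append, List.mem_cons] at hx
    rcases hx with hx | rfl | hx
    · exact hU x (by simp [hx])
    · rw [Matrix.conjTranspose_smul, smul_mul_smul_comm, hU f (by simp)]; simp
    · exact hU x (by simp [hx])

theorem complex (n : ℕ) : CliffordExists ℂ (2 ^ (n / 2)) 0 n := by
  induction n using Nat.strong_induction_on with
  | _ n ih =>
    match n with
    | 0 => exact zero
    | 1 => exact one_zero.complex_succ
    | n + 2 =>
      rw [show (n + 2) / 2 = n / 2 + 1 by omega, pow_succ']
      exact (ih n (by omega)).succ_succ.complex_succ

theorem real_zero_three : CliffordExists ℝ 4 0 3 := one_zero.succ_succ.all_neg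

/-- The types run (1, 0), (2, 1), (3, 2), (4, 3), with sizes 1, 2, 4, 8; exchanging four generators
gives (0, 7). -/
theorem real_zero_seven : CliffordExists ℝ 8 0 7 :=
  one_zero.succ_succ.succ_succ.succ_succ.exchange

theorem real_add_eight (h : CliffordExists ℝ N 0 q) : CliffordExists ℝ (16 * N) 0 (q + 8) := by
  have := h.succ_succ.succ_succ.succ_succ.succ_succ.exchange
  rwa [show 2 * (2 * (2 * (2 * N))) = 16 * N by ring] at this

theorem real (n : ℕ) : CliffordExists ℝ (kappaR (n + 1)) 0 n := by
  induction n using Nat.strong_induction_on with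
  | _ n ih =>
    match n with
    | 0 => exact zero
    | 1 => exact zero.succ_succ.pred_left
    | 2 => exact real_zero_three.pred_right
    | 3 => exact real_zero_three
    | 4 => exact real_zero_seven.pred_right.pred_right.pred_right
    | 5 => exact real_zero_seven.pred_right.pred_right
    | 6 => exact real_zero_seven.pred_right
    | 7 => exact real_zero_seven
    | n + 8 => rw [kappaR_add_eight]; exact (ih n (by omega)).real_add_eight

/-- A unitary Clifford system, indexed by `Fin n`. -/
theorem exists_fun {n : ℕ} (h : CliffordExists K N 0 n) :
    ∃ (I : Type) (_ : Fintype I) (_ : DecidableEq I) (w : Fin n → Matrix I I K),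
      Fintype.card I = N ∧ (∀ j, w j * w j = -1) ∧ (∀ j, (w j)ᴴ = -w j) ∧
        ∀ j k, j ≠ k → w j * w k = -(w k * w j) := by
  obtain ⟨I, _, _, P, Q, hN, hPQ, hU, hp, rfl⟩ := h
  obtain rfl := List.length_eq_zero_iff.1 hp
  have hsq : ∀ j : Fin Q.length, Q.get j * Q.get j = -1 := fun j =>
    hPQ.sq_neg _ (List.get_mem _ _)
  refine ⟨I, _, _, Q.get, hN, hsq, fun j => ?_, fun j k hjk => ?_⟩
  -- A unitary of square -1 has inverse equal both to its adjoint and to its negative.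
  · have h1 : (Q.get j)ᴴ * Q.get j = 1 := hU _ (by simp)
    calc (Q.get j)ᴴ = -((Q.get j)ᴴ * (Q.get j * Q.get j)) := by rw [hsq]; simp
      _ = _ := by rw [← Matrix.mul_assoc, h1, Matrix.one_mul]
  · have hpw := List.pairwise_iff_get.1 (by simpa using hPQ.pairwise)
    rcases lt_or_gt_of_ne hjk with h | h
    · exact hpw j k h
    · rw [hpw k j h, neg_neg]

end CliffordExists

/-- A family of matrices for which every real unit combination `Y` has `Y * Yᴴ = α` and
`Yᴴ * Y = β`, expressed by polarization. -/
structure IsMaskFamily {𝕜 ι A B : Type*} [CommRing 𝕜] [StarRing 𝕜] [Fintype A] [Fintype B]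
    (X : ι → Matrix A B 𝕜) (α : Matrix A A 𝕜) (β : Matrix B B 𝕜) : Prop where
  left_self : ∀ j, X j * (X j)ᴴ = α
  right_self : ∀ j, (X j)ᴴ * X j = β
  left : ∀ j k, j ≠ k → X j * (X k)ᴴ + X k * (X j)ᴴ = 0
  right : ∀ j k, j ≠ k → (X j)ᴴ * X k + (X k)ᴴ * X j = 0

/-! ### Clifford relations hidden in a mask family -/

namespace IsMaskFamily

section Relations

variable {𝕜 ι A B : Type*} [CommRing 𝕜] [StarRing 𝕜] [Fintype A] [Fintype B]
  {X : ι → Matrix A B 𝕜} {α : Matrix A A 𝕜} {β : Matrix B B 𝕜}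

theorem mul_right (h : IsMaskFamily X α β) (j : ι) : X j * β = α * X j := by
  rw [← h.right_self j, ← Matrix.mul_assoc, h.left_self]

theorem conjTranspose_mul_left (h : IsMaskFamily X α β) (j : ι) : (X j)ᴴ * α = β * (X j)ᴴ := by
  rw [← h.left_self j, ← Matrix.mul_assoc, h.right_self]

theorem comm (h : IsMaskFamily X α β) (j k : ι) : X j * (X k)ᴴ * α = α * (X j * (X k)ᴴ) := by
  rw [Matrix.mul_assoc, h.conjTranspose_mul_left, ← Matrix.mul_assoc, h.mul_right,
    Matrix.mul_assoc]

theorem skew (h : IsMaskFamily X α β) {j k : ι} (hjk : j ≠ k) :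
    (X j * (X k)ᴴ)ᴴ = -(X j * (X k)ᴴ) := by
  rw [Matrix.conjTranspose_mul, Matrix.conjTranspose_conjTranspose]
  exact eq_neg_of_add_eq_zero_right (h.left j k hjk)

/-- Reverse the second factor by the polarized relation; the inner product of `X i` with its adjoint
is β, and it moves left past `X j` as α. -/
theorem mul_mul (h : IsMaskFamily X α β) {i j k : ι} (hk : k ≠ i) :
    X j * (X i)ᴴ * (X k * (X i)ᴴ) = -(α * (X j * (X k)ᴴ)) := by
  have hik : (X k) * (X i)ᴴ = -(X i * (X k)ᴴ) := eq_neg_of_add_eq_zero_left (h.left k i hk)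
  rw [hik, Matrix.mul_neg, Matrix.mul_assoc, ← Matrix.mul_assoc (X i)ᴴ, h.right_self,
    ← Matrix.mul_assoc, h.mul_right, Matrix.mul_assoc]

theorem mul_self (h : IsMaskFamily X α β) {i k : ι} (hk : k ≠ i) :
    X k * (X i)ᴴ * (X k * (X i)ᴴ) = -(α * α) := by
  rw [h.mul_mul hk, h.left_self]

theorem anticomm (h : IsMaskFamily X α β) {i j k : ι} (hj : j ≠ i) (hk : k ≠ i) (hjk : j ≠ k) :
    X j * (X i)ᴴ * (X k * (X i)ᴴ) = -(X k * (X i)ᴴ * (X j * (X i)ᴴ)) := by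
  rw [h.mul_mul hk, h.mul_mul hj, eq_neg_of_add_eq_zero_left (h.left j k hjk), Matrix.mul_neg]

theorem isHermitian (h : IsMaskFamily X α β) (j : ι) : α.IsHermitian := by
  rw [← h.left_self j]
  exact Matrix.isHermitian_mul_conjTranspose_self _

end Relations

end IsMaskFamily

/-- The `T j` preserve the eigenspace because they commute with `a`; there their squares are -c², so
dividing by `c` normalizes them. -/
theorem isClifford_eigenspace {K V : Type*} [Field K] [AddCommGroup V] [Module K V] {n : ℕ}
    {a : Module.End K V} {T : Fin n → Module.End K V} (hc : ∀ j, T j * a = a * T j)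
    (hsq : ∀ j, T j * T j = -(a * a)) (hT : ∀ j k, j ≠ k → T j * T k = -(T k * T j))
    {c : K} (hc0 : c ≠ 0) :
    ∃ Q : List (Module.End K (a.eigenspace c)), IsClifford [] Q ∧ Q.length = n := by
  have hmem : ∀ j, ∀ v ∈ a.eigenspace c, T j v ∈ a.eigenspace c := by
    intro j v hv
    rw [Module.End.mem_eigenspace_iff] at hv ⊢
    rw [← Module.End.mul_apply, ← hc, Module.End.mul_apply, hv, map_smul]
  let W : Fin n → Module.End K (a.eigenspace c) := fun j => c⁻¹ • (T j).restrict (hmem j)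
  have hW : ∀ j v, ((W j v : a.eigenspace c) : V) = c⁻¹ • T j v := fun j v => rfl
  refine ⟨List.ofFn W, ⟨?_, by simp, ?_⟩, by simp⟩
  · rw [List.nil_append, List.pairwise_ofFn]
    intro j k hjk
    ext v
    have := LinearMap.congr_fun (hT j k hjk.ne) v
    simp only [Module.End.mul_apply, LinearMap.neg_apply] at this
    simp [Module.End.mul_apply, hW, this]
  · intro x hx
    obtain ⟨j, rfl⟩ := (List.mem_ofFn' _ _).1 hx
    ext v
    have h1 := LinearMap.congr_fun (hsq j) v
    have h2 : a v = c • (v : V) := Module.End.mem_eigenspace_iff.1 v.2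
    simp only [Module.End.mul_apply, LinearMap.neg_apply, h2, map_smul] at h1
    simp [Module.End.mul_apply, hW, h1, hc0]

/-- A Hermitian matrix is semisimple, so its eigenspaces are its generalized eigenspaces, whose
dimensions are the algebraic multiplicities. -/
theorem finrank_eigenspace_toEuclideanLin {𝕜 A : Type*} [RCLike 𝕜] [Fintype A] [DecidableEq A]
    {α : Matrix A A 𝕜} (hα : α.IsHermitian) (c : 𝕜) :
    Module.finrank 𝕜 (Module.End.eigenspace (Matrix.toLpLinAlgEquiv 2 α) c) =
      α.charpoly.rootMultiplicity c := by
  have hs := Matrix.isSymmetric_toEuclideanLin_iff.2 hα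
  have h1 := hs.isFinitelySemisimple.maxGenEigenspace_eq_eigenspace c
  have h2 := LinearMap.finrank_maxGenEigenspace_eq (Matrix.toEuclideanLin α) c
  rw [h1] at h2
  refine h2.trans ?_
  congr 1
  have h3 : Matrix.toEuclideanLin α = Matrix.toLin (PiLp.basisFun 2 𝕜 A) (PiLp.basisFun 2 𝕜 A) α :=
    by rw [← Matrix.toLpLin_eq_toLin]
  rw [h3, ← LinearMap.charpoly_toMatrix _ (PiLp.basisFun 2 𝕜 A),
    LinearMap.toMatrix_toLin]

theorem IsMaskFamily.dvd_rootMultiplicity {𝕜 A B : Type} [RCLike 𝕜] [Fintype A] [DecidableEq A]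
    [Fintype B] {n N : ℕ} {X : Fin (n + 1) → Matrix A B 𝕜} {α : Matrix A A 𝕜} {β : Matrix B B 𝕜}
    (h : IsMaskFamily X α β) (hN : CliffordDvd 𝕜 N 0 n) {c : 𝕜} (hc : c ≠ 0) :
    N ∣ α.charpoly.rootMultiplicity c := by
  rw [← finrank_eigenspace_toEuclideanLin (h.isHermitian 0)]
  obtain ⟨Q, hQ, hn⟩ := isClifford_eigenspace (a := Matrix.toLpLinAlgEquiv 2 α)
    (T := fun j : Fin n => Matrix.toLpLinAlgEquiv 2 (X j.succ * (X 0)ᴴ))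
    (fun j => by rw [← map_mul, ← map_mul, h.comm])
    (fun j => by rw [← map_mul, ← map_mul, ← map_neg, h.mul_self (Fin.succ_ne_zero j)])
    (fun j k hjk => by
      rw [← map_mul, ← map_mul, ← map_neg, h.anticomm (Fin.succ_ne_zero j) (Fin.succ_ne_zero k)
        (by simpa using hjk)]) hc
  exact hN _ _ _ hQ rfl hn

/-! ### Masking real states as relations between columns -/

section Columns

variable {ι A B : Type*}

/-- The columns of a linear map into `𝕜ᴬ ⊗ 𝕜ᴮ`, as matrices. -/
def columns {𝕜 : Type*} (M : Matrix (A × B) ι 𝕜) (j : ι) : Matrix A B 𝕜 :=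
  Matrix.of fun a b => M (a, b) j

@[simp]
theorem columns_apply {𝕜 : Type*} (M : Matrix (A × B) ι 𝕜) (j : ι) (a : A) (b : B) :
    columns M j a b = M (a, b) j := rfl

theorem conjTranspose_mul_apply [Fintype A] [Fintype B] (M : Matrix (A × B) ι ℂ) (j k : ι) :
    (Mᴴ * M) j k = ((columns M j)ᴴ * columns M k).trace := by
  simp only [Matrix.trace, Matrix.diag_apply, Matrix.mul_apply, Matrix.conjTranspose_apply,
    columns_apply]
  rw [Fintype.sum_prod_type, Finset.sum_comm]

variable [Fintype ι]

theorem conjBy_apply {N : Type*} (M : Matrix N ι ℂ) (ρ : Matrix ι ι ℂ) (x y : N) :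
    conjBy M ρ x y = ∑ j, ∑ k, ρ j k • (M x j * star (M y k)) := by
  simp only [conjBy, Matrix.mul_apply, Finset.sum_mul, Matrix.conjTranspose_apply, smul_eq_mul]
  rw [Finset.sum_comm]
  refine Finset.sum_congr rfl fun j _ => Finset.sum_congr rfl fun k _ => ?_
  ring

theorem partialTraceB_conjBy [Fintype B] (M : Matrix (A × B) ι ℂ) (ρ : Matrix ι ι ℂ) :
    partialTraceB (conjBy M ρ) = ∑ j, ∑ k, ρ j k • (columns M j * (columns M k)ᴴ) := by
  ext a a'
  simp only [partialTraceB, Matrix.of_apply, conjBy_apply, Matrix.sum_apply, Matrix.smul_apply,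
    Matrix.mul_apply, Matrix.conjTranspose_apply, columns_apply, Finset.smul_sum]
  rw [Finset.sum_comm]
  exact Finset.sum_congr rfl fun j _ => Finset.sum_comm

/-- The transpose turns the sum over the row index into a matrix product; this is why τ_B enters the
mask family transposed. -/
theorem partialTraceA_conjBy [Fintype A] (M : Matrix (A × B) ι ℂ) (ρ : Matrix ι ι ℂ) :
    (partialTraceA (conjBy M ρ))ᵀ = ∑ j, ∑ k, ρ j k • ((columns M k)ᴴ * columns M j) := by
  ext b b'
  simp only [partialTraceA, Matrix.of_apply, conjBy_apply, Matrix.sum_apply, Matrix.smul_apply,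
    Matrix.mul_apply, Matrix.conjTranspose_apply, columns_apply, Finset.smul_sum,
    Matrix.transpose_apply]
  rw [Finset.sum_comm]
  refine Finset.sum_congr rfl fun j _ => ?_
  rw [Finset.sum_comm]
  refine Finset.sum_congr rfl fun k _ => Finset.sum_congr rfl fun a _ => ?_
  rw [mul_comm (M (a, b') j)]

variable {E : Type*} [AddCommGroup E] [Module ℂ E]

/-- The pure real state with real amplitude vector `v`. -/
def pureState (v : ι → ℝ) : Matrix ι ι ℂ := Matrix.of fun j k => ((v j * v k : ℝ) : ℂ)

theorem pureState_mem {v : ι → ℝ} (hv : ∑ j, v j * v j = 1) :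
    pureState v ∈ realDensityMatrices ι := by
  refine ⟨⟨?_, ?_⟩, fun i j => Complex.ofReal_im _⟩
  · have : pureState v = Matrix.vecMulVec (fun j => (v j : ℂ)) (star fun j => (v j : ℂ)) := by
      ext i j
      simp [pureState, Matrix.vecMulVec_apply]
    rw [this]
    exact Matrix.posSemidef_vecMulVec_self_star _
  · simp only [Matrix.trace, Matrix.diag_apply, pureState, Matrix.of_apply]
    exact_mod_cast hv

variable [DecidableEq ι]

theorem sum_single_mul_self (j : ι) :
    ∑ i, (Pi.single j 1 : ι → ℝ) i * (Pi.single j 1 : ι → ℝ) i = 1 := by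
  simp [Pi.single_apply]

/-- A real unit vector with support `{j, k}`. -/
noncomputable def pairVec (j k : ι) : ι → ℝ := Pi.single j (3 / 5) + Pi.single k (4 / 5)

theorem sum_pairVec_mul_self {j k : ι} (hjk : j ≠ k) :
    ∑ i, pairVec j k i * pairVec j k i = 1 := by
  simp [pairVec, Pi.single_apply, add_mul, mul_add, Finset.sum_add_distrib, hjk, hjk.symm]
  norm_num

theorem sum_pureState_single (F : ι → ι → E) (j : ι) :
    ∑ i, ∑ l, pureState (Pi.single j 1) i l • F i l = F j j := by
  simp [pureState, Pi.single_apply]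

/-- The amplitudes 3/5 and 4/5 form a rational unit vector with both entries nonzero, so the cross
term can be isolated without square roots. -/
theorem sum_pureState_pairVec (F : ι → ι → E) (j k : ι) :
    ∑ i, ∑ l, pureState (pairVec j k) i l • F i l =
      (9 / 25 : ℂ) • F j j + (16 / 25 : ℂ) • F k k + (12 / 25 : ℂ) • (F j k + F k j) := by
  have key : ∀ G : ι → E, ∑ l, (pairVec j k l : ℂ) • G l =
      (3 / 5 : ℂ) • G j + (4 / 5 : ℂ) • G k := fun G => by
    simp [pairVec, Pi.single_apply, add_smul, Finset.sum_add_distrib, apply_ite Complex.ofReal]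
  have hps : ∀ i l, pureState (pairVec j k) i l • F i l =
      (pairVec j k i : ℂ) • ((pairVec j k l : ℂ) • F i l) := fun i l => by
    simp [pureState, mul_smul]
  simp_rw [hps, ← Finset.smul_sum, key]
  module

/-- A Hermitian matrix with real entries is symmetric, so only the symmetrization of `F`
contributes: its off-diagonal part is 0 and its diagonal part gives the trace times `τ`. -/
theorem sum_smul_of_real {F : ι → ι → E} {τ : E} (h1 : ∀ j, F j j = τ)
    (h2 : ∀ j k, j ≠ k → F j k + F k j = 0) {ρ : Matrix ι ι ℂ} (hρ : ρ ∈ realDensityMatrices ι) :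
    ∑ j, ∑ k, ρ j k • F j k = τ := by
  have hsymm : ∀ j k, ρ j k = ρ k j := fun j k => by
    rw [← hρ.1.1.isHermitian.apply j k]
    exact (Complex.conj_eq_iff_im.2 (hρ.2 k j))
  have h : ∀ j k, ρ j k • (F j k + F k j) = if j = k then ρ j j • ((2 : ℂ) • τ) else 0 := by
    intro j k
    split_ifs with hjk
    · subst hjk
      rw [h1, two_smul]
    · rw [h2 j k hjk, smul_zero]
  have hsum : (2 : ℂ) • ∑ j, ∑ k, ρ j k • F j k = (2 : ℂ) • τ := by
    calc (2 : ℂ) • ∑ j, ∑ k, ρ j k • F j k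
        = ∑ j, ∑ k, ρ j k • F j k + ∑ k, ∑ j, ρ j k • F j k := by
          rw [two_smul, Finset.sum_comm (f := fun k j => ρ j k • F j k)]
      _ = ∑ j, ∑ k, ρ j k • (F j k + F k j) := by
          simp only [smul_add, Finset.sum_add_distrib]
          congr 1
          exact Finset.sum_congr rfl fun j _ => Finset.sum_congr rfl fun k _ => by rw [hsymm]
      _ = ρ.trace • ((2 : ℂ) • τ) := by
          simp [h, Matrix.trace, Finset.sum_smul]
      _ = _ := by rw [hρ.1.2, one_smul]
  exact smul_right_injective E two_ne_zero hsum

theorem relations_of_sum_smul {F : ι → ι → E} {τ : E}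
    (h : ∀ ρ ∈ realDensityMatrices ι, ∑ j, ∑ k, ρ j k • F j k = τ) :
    (∀ j, F j j = τ) ∧ ∀ j k, j ≠ k → F j k + F k j = 0 := by
  have h1 : ∀ j, F j j = τ := fun j => by
    rw [← h _ (pureState_mem (sum_single_mul_self j)), sum_pureState_single]
  refine ⟨h1, fun j k hjk => ?_⟩
  have h2 := h _ (pureState_mem (sum_pairVec_mul_self hjk))
  rw [sum_pureState_pairVec, h1, h1, ← add_smul] at h2
  norm_num at h2
  rw [← smul_add] at h2
  exact (smul_eq_zero.1 h2).resolve_left (by norm_num)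

theorem isMaskFamily_of_isMaskerWith [Fintype A] [Fintype B] {M : Matrix (A × B) ι ℂ}
    {τA : Matrix A A ℂ} {τB : Matrix B B ℂ}
    (h : IsMaskerWith M (realDensityMatrices ι) τA τB) :
    IsMaskFamily (columns M) τA τBᵀ := by
  obtain ⟨h1, h2⟩ := relations_of_sum_smul (F := fun j k => columns M j * (columns M k)ᴴ)
    fun ρ hρ => by rw [← partialTraceB_conjBy, h.reducedA ρ hρ]
  obtain ⟨h3, h4⟩ := relations_of_sum_smul (F := fun j k => (columns M k)ᴴ * columns M j)
    fun ρ hρ => by rw [← partialTraceA_conjBy, h.reducedB ρ hρ]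
  exact ⟨h1, h3, h2, fun j k hjk => h4 k j hjk.symm⟩

theorem IsMaskFamily.isMaskerWith [Fintype A] [Fintype B] {M : Matrix (A × B) ι ℂ}
    {τA : Matrix A A ℂ} {τB : Matrix B B ℂ} (h : IsMaskFamily (columns M) τA τBᵀ)
    (hM : Mᴴ * M = 1) : IsMaskerWith M (realDensityMatrices ι) τA τB := by
  refine ⟨hM, fun ρ hρ => ?_, fun ρ hρ => ?_⟩
  · rw [partialTraceB_conjBy]
    exact sum_smul_of_real (F := fun j k => columns M j * (columns M k)ᴴ) h.left_self h.left hρ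
  · rw [← Matrix.transpose_inj, partialTraceA_conjBy]
    exact sum_smul_of_real (F := fun j k => (columns M k)ᴴ * columns M j) h.right_self
      (fun j k hjk => h.right k j hjk.symm) hρ

end Columns

/-! ### Necessity of the divisibility conditions -/

section Necessity

theorem star_ofReal (x : ℝ) : star (x : ℂ) = x := Complex.conj_ofReal x

theorem rootMultiplicity_of_nonzeroSpectrum {A : Type*} [Fintype A] [DecidableEq A]
    {τ : Matrix A A ℂ} {σ : Multiset ℝ} (h : nonzeroSpectrum τ = σ.map Complex.ofReal) {c : ℝ}
    (hc : c ≠ 0) : τ.charpoly.rootMultiplicity (c : ℂ) = σ.count c := by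
  rw [← Multiset.count_map_eq_count' Complex.ofReal σ Complex.ofReal_injective, ← h,
    nonzeroSpectrum, Multiset.count_filter_of_pos (by simpa using hc), Polynomial.count_roots]

theorem count_spectrumMultiset {r : ℕ} {lam : Fin r → ℝ} {m : Fin r → ℕ}
    (h : IsStateSpectrum lam m) (o : Fin r) : (spectrumMultiset lam m).count (lam o) = m o := by
  simp [spectrumMultiset, Multiset.count_sum', Multiset.count_replicate, h.injective.eq_iff]

theorem dvd_of_existsComplexMasker {n r : ℕ} {lam : Fin r → ℝ} {m : Fin r → ℕ}
    (hs : IsStateSpectrum lam m) (h : ExistsComplexMasker (n + 1) (spectrumMultiset lam m))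
    (o : Fin r) : kappa (n + 1) ∣ m o := by
  obtain ⟨a, b, M, τA, τB, hM, hA, -⟩ := h
  have h0 : lam o ≠ 0 := (hs.pos o).ne'
  rw [← count_spectrumMultiset hs o, ← rootMultiplicity_of_nonzeroSpectrum hA h0]
  exact (isMaskFamily_of_isMaskerWith hM).dvd_rootMultiplicity (CliffordDvd.complex n)
    (by exact_mod_cast h0)

/-- An isometry that maps real states to real states is real up to a phase. -/
theorem exists_real_of_conjBy_real {N ι : Type*} [Fintype N] [Fintype ι] [DecidableEq ι]
    [Nonempty ι] {M : Matrix N ι ℂ} (hM : Mᴴ * M = 1)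
    (hr : ∀ ρ ∈ realDensityMatrices ι, ∀ x y, (conjBy M ρ x y).im = 0) :
    ∃ (c : ℂ) (R : Matrix N ι ℝ), c * star c = 1 ∧ M = c • R.map Complex.ofReal := by
  have horth : ∀ j k, ∑ x, star (M x j) * M x k = if j = k then 1 else 0 := fun j k => by
    rw [← Matrix.one_apply, ← hM]; rfl
  have hdiag : ∀ j x y, (M x j * star (M y j)).im = 0 := fun j x y => by
    have := hr _ (pureState_mem (sum_single_mul_self j)) x y
    rwa [conjBy_apply, sum_pureState_single (fun j k => M x j * star (M y k))] at this
  have hcross : ∀ j k, j ≠ k → ∀ x y,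
      (M x j * star (M y k) + M x k * star (M y j)).im = 0 := fun j k hjk x y => by
    have := hr _ (pureState_mem (sum_pairVec_mul_self hjk)) x y
    rw [conjBy_apply, sum_pureState_pairVec (fun j k => M x j * star (M y k))] at this
    have h1 := hdiag j x y
    have h2 := hdiag k x y
    simp only [smul_eq_mul, Complex.add_im] at this ⊢
    rw [show (9 / 25 : ℂ) = ((9 / 25 : ℝ) : ℂ) by norm_num,
      show (16 / 25 : ℂ) = ((16 / 25 : ℝ) : ℂ) by norm_num,
      show (12 / 25 : ℂ) = ((12 / 25 : ℝ) : ℂ) by norm_num, Complex.im_ofReal_mul,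
      Complex.im_ofReal_mul, Complex.im_ofReal_mul, h1, h2, Complex.add_im] at this
    linarith
  obtain ⟨i⟩ := ‹Nonempty ι›
  obtain ⟨z, hz⟩ : ∃ z, M z i ≠ 0 := by
    by_contra! hz
    have := horth i i
    simp [hz] at this
  have hz' : ‖M z i‖ ≠ 0 := norm_ne_zero_iff.2 hz
  -- The phase of one nonzero entry; dividing it out makes that entry positive and leaves all
  -- products `M x j * star (M y k)` unchanged.
  let c : ℂ := M z i / ‖M z i‖
  have hcc : c * star c = 1 := by
    rw [Complex.star_def, Complex.mul_conj']
    simp [c, hz]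
  have hcc' : star c * c = 1 := by rw [mul_comm, hcc]
  let L : N → ι → ℂ := fun x j => star c * M x j
  have hL : ∀ x y j k, L x j * star (L y k) = M x j * star (M y k) := fun x y j k => by
    calc L x j * star (L y k) = (c * star c) * (M x j * star (M y k)) := by
          simp only [L, star_mul', star_star]; ring
      _ = _ := by rw [hcc, one_mul]
  have hLo : ∀ j k, ∑ x, star (L x j) * L x k = if j = k then 1 else 0 := fun j k => by
    rw [← horth]
    refine Finset.sum_congr rfl fun x _ => ?_
    rw [mul_comm, hL, mul_comm]
  have hLz : L z i = (‖M z i‖ : ℂ) := by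
    have h1 : star (M z i) * M z i = (‖M z i‖ : ℂ) ^ 2 := by
      rw [Complex.star_def, Complex.conj_mul']
    simp only [L, c, star_div₀]
    rw [star_ofReal, div_mul_eq_mul_div, h1]
    field_simp
  have hi : ∀ x, (L x i).im = 0 := fun x => by
    have := hdiag i x z
    rw [← hL, hLz, Complex.star_def, Complex.conj_ofReal, Complex.im_mul_ofReal] at this
    exact (mul_eq_zero.1 this).resolve_right hz'
  have hone : ∑ x, (L x i).re * (L x i).re = 1 := by
    have := congrArg Complex.re (hLo i i)
    simpa [Complex.mul_re, hi] using this
  have him : ∀ x k, (L x k).im = 0 := by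
    intro x k
    by_cases hk : i = k
    · rw [← hk, hi]
    -- The imaginary part of column `k` is a multiple of the real column `i`. Orthogonality of the
    -- two columns then forces the multiple to be 0.
    have hb : ∀ x, (L x k).im * ‖M z i‖ = (L x i).re * (L z k).im := fun x => by
      have := hcross i k hk x z
      rw [← hL, ← hL, hLz] at this
      simp [Complex.mul_im, hi] at this
      linarith
    have ho : ∑ x, (L x i).re * (L x k).im = 0 := by
      have := congrArg Complex.im (hLo i k)
      simpa [Complex.mul_im, hi, hk] using this
    have hzk : (L z k).im = 0 := by
      calc (L z k).im = (∑ x, (L x i).re * (L x i).re) * (L z k).im := by rw [hone, one_mul]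
        _ = (∑ x, (L x i).re * (L x k).im) * ‖M z i‖ := by
          rw [Finset.sum_mul, Finset.sum_mul]
          refine Finset.sum_congr rfl fun x _ => ?_
          rw [mul_assoc, mul_assoc, hb]
        _ = 0 := by rw [ho, zero_mul]
    have := hb x
    rw [hzk, mul_zero] at this
    exact (mul_eq_zero.1 this).resolve_right hz'
  refine ⟨c, Matrix.of fun x j => (L x j).re, hcc, ?_⟩
  ext x j
  have hre : ((L x j).re : ℂ) = L x j := by
    apply Complex.ext <;> simp [him]
  simp only [Matrix.smul_apply, Matrix.map_apply, Matrix.of_apply, hre, smul_eq_mul, L]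
  rw [← mul_assoc, hcc, one_mul]

theorem map_ofReal_mul_conjTranspose {A B C : Type*} [Fintype B] {c : ℂ} (hc : c * star c = 1)
    (R : Matrix A B ℝ) (S : Matrix C B ℝ) :
    (c • R.map Complex.ofReal) * (c • S.map Complex.ofReal)ᴴ =
      (R * Sᴴ).map Complex.ofReal := by
  ext x y
  have : ∀ z, c * (R x z : ℂ) * star (c * (S y z : ℂ)) = (R x z : ℂ) * (S y z : ℂ) := fun z => by
    rw [star_mul', star_ofReal]
    calc _ = (c * star c) * ((R x z : ℂ) * (S y z : ℂ)) := by ring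
      _ = _ := by rw [hc, one_mul]
  simp [Matrix.mul_apply] at this ⊢
  exact Finset.sum_congr rfl fun z _ => this z

theorem map_ofReal_conjTranspose_mul {A B C : Type*} [Fintype B] {c : ℂ} (hc : c * star c = 1)
    (R : Matrix B A ℝ) (S : Matrix B C ℝ) :
    (c • R.map Complex.ofReal)ᴴ * (c • S.map Complex.ofReal) =
      (Rᴴ * S).map Complex.ofReal := by
  ext x y
  have : ∀ z, star (c * (R z x : ℂ)) * (c * (S z y : ℂ)) = (R z x : ℂ) * (S z y : ℂ) := fun z => by
    rw [star_mul', star_ofReal]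
    calc _ = (c * star c) * ((R z x : ℂ) * (S z y : ℂ)) := by ring
      _ = _ := by rw [hc, one_mul]
  simp [Matrix.mul_apply] at this ⊢
  exact Finset.sum_congr rfl fun z _ => this z

/-- The common phase cancels in every product of a column with an adjoint, so the relations descend
to ℝ. -/
theorem IsMaskFamily.exists_real {ι A B : Type*} [Fintype A] [Fintype B] [Nonempty ι]
    {R : ι → Matrix A B ℝ} {c : ℂ} (hc : c * star c = 1) {α : Matrix A A ℂ} {β : Matrix B B ℂ}
    (h : IsMaskFamily (fun j => c • (R j).map Complex.ofReal) α β) :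
    ∃ (α' : Matrix A A ℝ) (β' : Matrix B B ℝ), IsMaskFamily R α' β' ∧
      α'.map Complex.ofReal = α := by
  obtain ⟨i⟩ := ‹Nonempty ι›
  have hl : ∀ j, (R j * (R j)ᴴ).map Complex.ofReal = α := fun j => by
    rw [← map_ofReal_mul_conjTranspose hc, h.left_self]
  have hr : ∀ j, ((R j)ᴴ * R j).map Complex.ofReal = β := fun j => by
    rw [← map_ofReal_conjTranspose_mul hc, h.right_self]
  refine ⟨R i * (R i)ᴴ, (R i)ᴴ * R i, ⟨fun j => ?_, fun j => ?_, fun j k hjk => ?_,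
    fun j k hjk => ?_⟩, hl i⟩
  · exact Matrix.map_injective Complex.ofReal_injective ((hl j).trans (hl i).symm)
  · exact Matrix.map_injective Complex.ofReal_injective ((hr j).trans (hr i).symm)
  · apply Matrix.map_injective Complex.ofReal_injective
    have := h.left j k hjk
    rw [map_ofReal_mul_conjTranspose hc, map_ofReal_mul_conjTranspose hc] at this
    beta_reduce
    rw [Matrix.map_add _ Complex.ofReal_add, this, Matrix.map_zero _ Complex.ofReal_zero]
  · apply Matrix.map_injective Complex.ofReal_injective
    have := h.right j k hjk
    rw [map_ofReal_conjTranspose_mul hc, map_ofReal_conjTranspose_mul hc] at this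
    beta_reduce
    rw [Matrix.map_add _ Complex.ofReal_add, this, Matrix.map_zero _ Complex.ofReal_zero]

theorem dvd_of_existsRealMasker {n r : ℕ} {lam : Fin r → ℝ} {m : Fin r → ℕ}
    (hs : IsStateSpectrum lam m) (h : ExistsRealMasker (n + 1) (spectrumMultiset lam m))
    (o : Fin r) : kappaR (n + 1) ∣ m o := by
  obtain ⟨a, b, M, ⟨τA, τB, hM, hA, -⟩, hreal⟩ := h
  have h0 : lam o ≠ 0 := (hs.pos o).ne'
  rw [← count_spectrumMultiset hs o, ← rootMultiplicity_of_nonzeroSpectrum hA h0]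
  obtain ⟨c, R, hc, hMR⟩ := exists_real_of_conjBy_real hM.isometry fun ρ hρ => (hreal ρ hρ).2
  have hcol : columns M = fun j => c • (columns R j).map Complex.ofReal := by
    funext j
    ext x y
    simp [hMR]
  have hf := isMaskFamily_of_isMaskerWith hM
  rw [hcol] at hf
  obtain ⟨α, β, hαβ, hα⟩ := hf.exists_real hc
  have hchar : τA.charpoly = α.charpoly.map Complex.ofRealHom := by
    rw [← hα]
    exact Matrix.charpoly_map α Complex.ofRealHom
  rw [hchar]
  -- The multiplicity of a real eigenvalue is the same over ℝ, where the stronger divisibility is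
  -- available.
  have := Polynomial.eq_rootMultiplicity_map (p := α.charpoly) (f := Complex.ofRealHom)
    Complex.ofReal_injective (lam o)
  rw [Complex.ofRealHom_eq_coe] at this
  rw [← this]
  exact hαβ.dvd_rootMultiplicity (CliffordDvd.real n) h0

end Necessity

/-! ### Maskers built from Clifford systems -/

section Sufficiency

open scoped Kronecker

theorem roots_charpoly_diagonal {I : Type*} [Fintype I] [DecidableEq I] (s : I → ℂ) :
    (Matrix.diagonal s).charpoly.roots = Finset.univ.val.map s := by
  rw [Matrix.charpoly_diagonal, Polynomial.roots_prod]
  · simp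
  · simp [Finset.prod_ne_zero_iff, Polynomial.X_sub_C_ne_zero]

theorem nonzeroSpectrum_diagonal {I : Type*} [Fintype I] [DecidableEq I] {s : I → ℝ}
    (hs : ∀ i, 0 < s i) :
    nonzeroSpectrum (Matrix.diagonal fun i => (s i : ℂ)) =
      (Finset.univ.val.map s).map Complex.ofReal := by
  rw [nonzeroSpectrum, roots_charpoly_diagonal, Multiset.map_map, Multiset.filter_eq_self.2]
  · rfl
  · intro z hz
    obtain ⟨i, -, rfl⟩ := Multiset.mem_map.1 hz
    exact_mod_cast (hs i).ne'

theorem IsMaskFamily.submatrix {ι I J : Type*} [Fintype I] [Fintype J] {X : ι → Matrix I I ℂ}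
    {α β : Matrix I I ℂ} (h : IsMaskFamily X α β) (e : J ≃ I) :
    IsMaskFamily (fun j => (X j).submatrix e e) (α.submatrix e e) (β.submatrix e e) := by
  refine ⟨fun j => ?_, fun j => ?_, fun j k hjk => ?_, fun j k hjk => ?_⟩
  · rw [Matrix.conjTranspose_submatrix, Matrix.submatrix_mul_equiv, h.left_self]
  · rw [Matrix.conjTranspose_submatrix, Matrix.submatrix_mul_equiv, h.right_self]
  · rw [Matrix.conjTranspose_submatrix, Matrix.conjTranspose_submatrix,
      Matrix.submatrix_mul_equiv, Matrix.submatrix_mul_equiv]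
    exact congrArg (fun Y : Matrix I I ℂ => Y.submatrix e e) (h.left j k hjk)
  · rw [Matrix.conjTranspose_submatrix, Matrix.conjTranspose_submatrix,
      Matrix.submatrix_mul_equiv, Matrix.submatrix_mul_equiv]
    exact congrArg (fun Y : Matrix I I ℂ => Y.submatrix e e) (h.right j k hjk)

/-- A mask family with diagonal marginals of trace one and trace-orthogonal members is a masker. -/
theorem exists_masker_of_isMaskFamily {d : ℕ} {I : Type*} [Fintype I] [DecidableEq I]
    {X : Fin d → Matrix I I ℂ} {s : I → ℝ} (hs : ∀ i, 0 < s i) (hsum : ∑ i, s i = 1)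
    (h : IsMaskFamily X (Matrix.diagonal fun i => (s i : ℂ)) (Matrix.diagonal fun i => (s i : ℂ)))
    (htr : ∀ j k, j ≠ k → ((X j)ᴴ * X k).trace = 0) :
    ∃ (a b : ℕ) (M : Matrix (Fin a × Fin b) (Fin d) ℂ),
      IsMaskerWithSpectrum M (realDensityMatrices (Fin d)) (Finset.univ.val.map s) ∧
        ((∀ j x y, (X j x y).im = 0) → ∀ x j, (M x j).im = 0) := by
  let e : Fin (Fintype.card I) ≃ I := (Fintype.equivFin I).symm
  let M : Matrix (Fin (Fintype.card I) × Fin (Fintype.card I)) (Fin d) ℂ :=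
    Matrix.of fun x j => X j (e x.1) (e x.2)
  have hcol : columns M = fun j => (X j).submatrix e e := rfl
  have hdiag : (Matrix.diagonal fun i => (s i : ℂ)).submatrix e e =
      Matrix.diagonal fun i => (s (e i) : ℂ) := Matrix.submatrix_diagonal_equiv _ e
  have hM : Mᴴ * M = 1 := by
    ext j k
    rw [conjTranspose_mul_apply, hcol, Matrix.conjTranspose_submatrix,
      Matrix.submatrix_mul_equiv]
    have ht : ∀ Y : Matrix I I ℂ, (Y.submatrix e e).trace = Y.trace := fun Y =>
      e.sum_comp fun i => Y i i
    rw [ht, Matrix.one_apply]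
    split_ifs with hjk
    · rw [hjk, h.right_self, Matrix.trace_diagonal]
      exact_mod_cast hsum
    · exact htr j k hjk
  have hf := h.submatrix e
  rw [hdiag] at hf
  have hspec : nonzeroSpectrum (Matrix.diagonal fun i => (s (e i) : ℂ)) =
      (Finset.univ.val.map s).map Complex.ofReal := by
    rw [nonzeroSpectrum_diagonal (s := fun i => s (e i)) fun i => hs _]
    congr 1
    rw [← Finset.map_univ_equiv e, Finset.map_val, Multiset.map_map]
    rfl
  refine ⟨_, _, M, ⟨_, _, IsMaskFamily.isMaskerWith (τB := Matrix.diagonal fun i => (s (e i) : ℂ))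
    ?_ hM, hspec, hspec⟩, fun hX x j => hX j _ _⟩
  rw [Matrix.diagonal_transpose, hcol]
  exact hf

/-- Skewness is the polarized relation with the identity; anticommutation is the relation among the
generators. -/
theorem isMaskFamily_cons {I : Type*} [Fintype I] [DecidableEq I] {n : ℕ}
    {w : Fin n → Matrix I I ℂ} (hsq : ∀ j, w j * w j = -1) (hskew : ∀ j, (w j)ᴴ = -w j)
    (hanti : ∀ j k, j ≠ k → w j * w k = -(w k * w j)) :
    IsMaskFamily (Fin.cons 1 w : Fin (n + 1) → Matrix I I ℂ) 1 1 := by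
  refine ⟨fun j => ?_, fun j => ?_, fun j k => ?_, fun j k => ?_⟩
  · cases j using Fin.cases <;> simp [hskew, hsq]
  · cases j using Fin.cases <;> simp [hskew, hsq]
  · cases j using Fin.cases <;> cases k using Fin.cases <;> simp [hskew]
    rename_i j k
    intro hjk
    simp [hanti j k hjk]
  · cases j using Fin.cases <;> cases k using Fin.cases <;> simp [hskew]
    rename_i j k
    intro hjk
    simp [hanti j k hjk]

/-- Tensoring with square roots prescribes the marginals: each `t i` then occurs as often as the
size of `I`. -/
theorem IsMaskFamily.kronecker_diagonal {ι I J : Type*} [Fintype I] [DecidableEq I] [Fintype J]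
    [DecidableEq J] {W : ι → Matrix I I ℂ} (h : IsMaskFamily W 1 1) {t : J → ℝ}
    (ht : ∀ i, 0 < t i) :
    IsMaskFamily (fun j => W j ⊗ₖ Matrix.diagonal fun i => (Real.sqrt (t i) : ℂ))
      (Matrix.diagonal fun p : I × J => (t p.2 : ℂ))
      (Matrix.diagonal fun p : I × J => (t p.2 : ℂ)) := by
  set D : Matrix J J ℂ := Matrix.diagonal fun i => (Real.sqrt (t i) : ℂ) with hD
  have hDD : D * Dᴴ = Matrix.diagonal fun i => (t i : ℂ) := by
    rw [hD, Matrix.diagonal_conjTranspose, Matrix.diagonal_mul_diagonal]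
    congr 1
    funext i
    rw [Pi.star_apply, star_ofReal, ← Complex.ofReal_mul, Real.mul_self_sqrt (ht i).le]
  have hDD' : Dᴴ * D = Matrix.diagonal fun i => (t i : ℂ) := by
    rw [← hDD, hD, Matrix.diagonal_conjTranspose, Matrix.diagonal_mul_diagonal,
      Matrix.diagonal_mul_diagonal]
    simp only [mul_comm]
  have hone : (1 : Matrix I I ℂ) ⊗ₖ (Matrix.diagonal fun i => (t i : ℂ)) =
      Matrix.diagonal fun p : I × J => (t p.2 : ℂ) := by
    rw [← Matrix.diagonal_one, Matrix.diagonal_kronecker_diagonal]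
    simp
  refine ⟨fun j => ?_, fun j => ?_, fun j k hjk => ?_, fun j k hjk => ?_⟩
  · rw [Matrix.conjTranspose_kronecker, ← Matrix.mul_kronecker_mul, h.left_self, hDD, hone]
  · rw [Matrix.conjTranspose_kronecker, ← Matrix.mul_kronecker_mul, h.right_self, hDD', hone]
  · simp only [Matrix.conjTranspose_kronecker, ← Matrix.mul_kronecker_mul]
    rw [← Matrix.add_kronecker, h.left j k hjk, Matrix.zero_kronecker]
  · simp only [Matrix.conjTranspose_kronecker, ← Matrix.mul_kronecker_mul]
    rw [← Matrix.add_kronecker, h.right j k hjk, Matrix.zero_kronecker]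

theorem trace_eq_zero_of_anticomm {I : Type*} [Fintype I] [DecidableEq I] {x y : Matrix I I ℂ}
    (h : x * y = -(y * x)) : (x * y).trace = 0 := by
  have := congrArg Matrix.trace h
  rw [Matrix.trace_neg, Matrix.trace_mul_comm y x] at this
  exact self_eq_neg.1 this

/-- Up to sign, x is the product of xy and y, which anticommute, and a product of anticommuting
matrices has trace 0. -/
theorem trace_eq_zero_of_clifford {I : Type*} [Fintype I] [DecidableEq I] {x y : Matrix I I ℂ}
    (hy : y * y = -1) (h : x * y = -(y * x)) : x.trace = 0 := by
  have h1 : (x * y * y).trace = 0 := by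
    apply trace_eq_zero_of_anticomm
    rw [h, Matrix.neg_mul, Matrix.mul_assoc, h, Matrix.mul_neg, neg_neg, ← Matrix.mul_assoc, hy]
  rw [Matrix.mul_assoc, hy, Matrix.mul_neg, Matrix.mul_one, Matrix.trace_neg] at h1
  exact neg_eq_zero.1 h1

theorem map_univ_prod_sigma {r : ℕ} {I : Type*} [Fintype I] (lam : Fin r → ℝ) (c : Fin r → ℕ) :
    (Finset.univ : Finset (I × (Σ o, Fin (c o)))).val.map (fun p => lam p.2.1) =
      spectrumMultiset lam fun o => Fintype.card I * c o := by
  have h1 : ∀ {T : Type _} [Fintype T] (f : T → ℝ),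
      (Finset.univ : Finset T).val.map f = ∑ t, ({f t} : Multiset ℝ) := fun f =>
    (Multiset.sum_map_singleton _).symm.trans (by rw [Multiset.map_map]; rfl)
  rw [h1, Fintype.sum_prod_type, spectrumMultiset]
  simp only [Fintype.sum_sigma, Finset.sum_const, Finset.card_univ, Fintype.card_fin,
    Finset.smul_sum, smul_smul, ← Multiset.nsmul_singleton]

/-- A skew-Hermitian trace-free Clifford system of matrices gives maskers. -/
theorem exists_masker_of_clifford {n r : ℕ} {I : Type} [Fintype I] [DecidableEq I]
    {w : Fin n → Matrix I I ℂ} (hsq : ∀ j, w j * w j = -1) (hskew : ∀ j, (w j)ᴴ = -w j)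
    (hanti : ∀ j k, j ≠ k → w j * w k = -(w k * w j)) (htr : ∀ j, (w j).trace = 0)
    {lam : Fin r → ℝ} {m : Fin r → ℕ} (hs : IsStateSpectrum lam m)
    (hdvd : ∀ o, Fintype.card I ∣ m o) :
    ∃ (a b : ℕ) (M : Matrix (Fin a × Fin b) (Fin (n + 1)) ℂ),
      IsMaskerWithSpectrum M (realDensityMatrices (Fin (n + 1))) (spectrumMultiset lam m) ∧
        ((∀ j x y, (w j x y).im = 0) → ∀ x j, (M x j).im = 0) := by
  choose c hc using hdvd
  obtain rfl : m = fun o => Fintype.card I * c o := funext hc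
  have hspec := map_univ_prod_sigma (I := I) lam c
  have hf := (isMaskFamily_cons hsq hskew hanti).kronecker_diagonal
    (t := fun p : (Σ o, Fin (c o)) => lam p.1) fun p => hs.pos _
  have hsum : ∑ p : I × (Σ o, Fin (c o)), lam p.2.1 = 1 := by
    rw [← hs.sum_eq_one, Finset.sum, hspec, spectrumMultiset,
      ← Multiset.coe_sumAddMonoidHom, map_sum]
    simp
  have hW : ∀ j k, j ≠ k → (((Fin.cons 1 w : Fin (n + 1) → Matrix I I ℂ) j)ᴴ *
      (Fin.cons 1 w : Fin (n + 1) → Matrix I I ℂ) k).trace = 0 := by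
    intro j k
    cases j using Fin.cases <;> cases k using Fin.cases <;> simp [hskew, htr]
    rename_i j k
    exact fun hjk => trace_eq_zero_of_anticomm (hanti j k hjk)
  obtain ⟨a, b, M, hM, hreal⟩ := exists_masker_of_isMaskFamily 
    (s := fun p : I × (Σ o, Fin (c o)) => lam p.2.1) (fun p => hs.pos p.2.1) hsum hf
    (fun j k hjk => by
      rw [Matrix.conjTranspose_kronecker, ← Matrix.mul_kronecker_mul, Matrix.trace_kronecker,
        hW j k hjk, zero_mul])
  rw [hspec] at hM
  refine ⟨a, b, M, hM, fun hw => hreal fun j x y => ?_⟩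
  have him : ((Fin.cons 1 w : Fin (n + 1) → Matrix I I ℂ) j x.1 y.1).im = 0 := by
    cases j using Fin.cases
    · rw [Fin.cons_zero, Matrix.one_apply]
      split_ifs <;> simp
    · exact hw _ _ _
  rw [Matrix.kronecker_apply, Matrix.diagonal_apply]
  split_ifs
  · rw [Complex.im_mul_ofReal, him, zero_mul]
  · simp

theorem existsComplexMasker_of_dvd {n r : ℕ} (hn : 2 ≤ n) {lam : Fin r → ℝ} {m : Fin r → ℕ}
    (hs : IsStateSpectrum lam m) (hdvd : ∀ o, kappa (n + 1) ∣ m o) :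
    ExistsComplexMasker (n + 1) (spectrumMultiset lam m) := by
  obtain ⟨I, _, _, w, hI, hsq, hskew, hanti⟩ := (CliffordExists.complex n).exists_fun
  have htr : ∀ j, (w j).trace = 0 := fun j => by
    -- Here d ≥ 3 enters: a second generator is needed to make each generator traceless.
    have : Nontrivial (Fin n) := Fin.nontrivial_iff_two_le.2 hn
    obtain ⟨k, hk⟩ := exists_ne j
    exact trace_eq_zero_of_clifford (hsq k) (hanti j k hk.symm)
  obtain ⟨a, b, M, hM, -⟩ := exists_masker_of_clifford hsq hskew hanti htr hs
    (fun o => by rw [hI]; exact hdvd o)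
  exact ⟨a, b, M, hM⟩

theorem hasRealOutput_of_real {ι A B : Type*} [Fintype ι] [DecidableEq ι] [Fintype A] [Fintype B]
    {M : Matrix (A × B) ι ℂ} (hM : Mᴴ * M = 1) (hr : ∀ x j, (M x j).im = 0) :
    HasRealOutput M (realDensityMatrices ι) := by
  intro ρ hρ
  refine ⟨⟨hρ.1.1.mul_mul_conjTranspose_same M, ?_⟩, fun x y => ?_⟩
  · rw [conjBy, Matrix.trace_mul_cycle, hM, Matrix.one_mul, hρ.1.2]
  · rw [conjBy_apply, Complex.im_sum]
    refine Finset.sum_eq_zero fun j _ => ?_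
    rw [Complex.im_sum]
    refine Finset.sum_eq_zero fun k _ => ?_
    simp [Complex.mul_im, hr, hρ.2]

theorem existsRealMasker_of_dvd {n r : ℕ} {lam : Fin r → ℝ} {m : Fin r → ℕ}
    (hs : IsStateSpectrum lam m) (hdvd : ∀ o, kappaR (n + 1) ∣ m o) :
    ExistsRealMasker (n + 1) (spectrumMultiset lam m) := by
  obtain ⟨I, _, _, w, hI, hsq, hskew, hanti⟩ := (CliffordExists.real n).exists_fun
  let φ : Matrix I I ℝ →+* Matrix I I ℂ := Complex.ofRealHom.mapMatrix
  have hφ : ∀ x i j, φ x i j = (x i j : ℂ) := fun _ _ _ => rfl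
  obtain ⟨a, b, M, hM, hreal⟩ := exists_masker_of_clifford (w := fun j => φ (w j))
    (fun j => by rw [← map_mul, hsq, map_neg, map_one])
    (fun j => by
      rw [← map_neg, ← hskew]
      ext x y
      simp [hφ])
    (fun j k hjk => by rw [← map_mul, ← map_mul, ← map_neg, hanti j k hjk])
    (fun j => by
      -- A real skew matrix is traceless, so no second generator is needed and d = 2 is covered.
      have h1 : (w j).trace = 0 := by
        have := congrArg Matrix.trace (hskew j)
        rw [Matrix.trace_conjTranspose, Matrix.trace_neg, star_trivial] at this
        exact self_eq_neg.1 this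
      have h2 : (φ (w j)).trace = ((w j).trace : ℂ) := by
        simp [Matrix.trace, hφ]
      rw [h2, h1, Complex.ofReal_zero]) hs
    (fun o => by rw [hI]; exact hdvd o)
  refine ⟨a, b, M, hM, ?_⟩
  obtain ⟨_, _, hMw, -⟩ := hM
  exact hasRealOutput_of_real hMw.isometry (hreal fun j x y => Complex.ofReal_im _)

end Sufficiency

/-! ### Complex maskers in dimension two -/

section Qubit

theorem existsComplexMasker_two {n : ℕ} {μ v : Fin n → ℝ} (hμ : ∀ l, 0 < μ l)
    (hsum : ∑ l, μ l = 1) (hv : ∀ l, v l = 1 ∨ v l = -1) (hvμ : ∑ l, v l * μ l = 0) :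
    ExistsComplexMasker 2 (Finset.univ.val.map μ) := by
  let t : Fin n → ℂ := fun l => (Real.sqrt (μ l) : ℂ)
  have ht : ∀ l, t l * t l = μ l := fun l => by
    rw [← Complex.ofReal_mul, Real.mul_self_sqrt (hμ l).le]
  have hts : ∀ l, star (t l) = t l := fun l => star_ofReal _
  have hvv : ∀ l, (v l : ℂ) * v l = 1 := fun l => by
    rcases hv l with h | h <;> simp [h]
  let u : Fin n → ℂ := fun l => Complex.I * v l * t l
  have hus : ∀ l, star (u l) = -u l := fun l => by
    simp only [u, star_mul', hts, star_ofReal, Complex.star_def, Complex.conj_I]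
    ring
  have huu : ∀ l, u l * u l = -μ l := fun l => by
    calc u l * u l = (Complex.I * Complex.I) * ((v l : ℂ) * v l) * (t l * t l) := by
          simp only [u]; ring
      _ = _ := by rw [hvv, ht, Complex.I_mul_I]; ring
  have htu : ∑ l, t l * u l = 0 := by
    have : ∀ l, t l * u l = Complex.I * ((v l * μ l : ℝ) : ℂ) := fun l => by
      calc t l * u l = Complex.I * v l * (t l * t l) := by simp only [u]; ring
        _ = _ := by rw [ht]; push_cast; ring
    simp only [this]
    rw [← Finset.mul_sum, ← Complex.ofReal_sum, hvμ]
    simp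
  have hst : star t = t := funext hts
  have hsu : star u = -u := funext hus
  -- The generator is diagonal with entries i v_l; orthogonality of the two columns is the vanishing
  -- of the signed sum.
  let X : Fin 2 → Matrix (Fin n) (Fin n) ℂ := ![Matrix.diagonal t, Matrix.diagonal u]
  have hX : IsMaskFamily X (Matrix.diagonal fun i => (μ i : ℂ))
      (Matrix.diagonal fun i => (μ i : ℂ)) := by
    refine ⟨fun j => ?_, fun j => ?_, fun j k => ?_, fun j k => ?_⟩
    · fin_cases j <;> simp [X, Matrix.diagonal_conjTranspose, hst, hsu, ht, huu]
    · fin_cases j <;> simp [X, Matrix.diagonal_conjTranspose, hst, hsu, ht, huu]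
    · fin_cases j <;> fin_cases k <;>
        simp [X, Matrix.diagonal_conjTranspose, hst, hsu, mul_comm]
    · fin_cases j <;> fin_cases k <;>
        simp [X, Matrix.diagonal_conjTranspose, hst, hsu, mul_comm]
  obtain ⟨a, b, M, hM, -⟩ := exists_masker_of_isMaskFamily hμ hsum hX (by
    intro j k
    fin_cases j <;> fin_cases k <;>
      simp [X, Matrix.diagonal_conjTranspose, hst, hsu, htu, mul_comm])
  exact ⟨a, b, M, hM⟩

/-- The spectrum of the square of a Hermitian matrix. -/
theorem roots_charpoly_mul_self {A : Type*} [Fintype A] [DecidableEq A] {K : Matrix A A ℂ}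
    (hK : K.IsHermitian) :
    (K * K).charpoly.roots =
      Finset.univ.val.map fun i => ((hK.eigenvalues i * hK.eigenvalues i : ℝ) : ℂ) := by
  have h : K * K = Unitary.conjStarAlgAut ℂ _ hK.eigenvectorUnitary
      (Matrix.diagonal fun i => ((hK.eigenvalues i * hK.eigenvalues i : ℝ) : ℂ)) := by
    conv_lhs => rw [hK.spectral_theorem, ← map_mul, Matrix.diagonal_mul_diagonal]
    simp
  rw [h, Unitary.conjStarAlgAut_apply, Matrix.charpoly_mul_comm, ← mul_assoc]
  simp only [Unitary.coe_star_mul_self, one_mul, roots_charpoly_diagonal]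

/-- Turns an equality of multisets into an indexing of `s` matched to `μ`; used with `f` the
absolute value, to attach a signed eigenvalue to each `μ l`. -/
theorem exists_eq_map_univ_of_map {f : ℝ → ℝ} : ∀ {n : ℕ} {μ : Fin n → ℝ} {s : Multiset ℝ},
    s.map f = Finset.univ.val.map μ →
      ∃ w : Fin n → ℝ, Finset.univ.val.map w = s ∧ ∀ l, f (w l) = μ l
  | 0, μ, s, h => ⟨μ, by
      have : s = 0 := by simpa using h
      simp [this], fun l => l.elim0⟩
  | n + 1, μ, s, h => by
      have hcons : ∀ g : Fin (n + 1) → ℝ, Finset.univ.val.map g =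
          g 0 ::ₘ Finset.univ.val.map fun l : Fin n => g l.succ := fun g => by
        rw [Fin.univ_val_map, Fin.univ_val_map, List.ofFn_succ, Multiset.cons_coe]
      rw [hcons, ← Multiset.map_eq_cons] at h
      obtain ⟨a, ha, hfa, ht⟩ := h
      obtain ⟨w, hw, hfw⟩ := exists_eq_map_univ_of_map ht
      refine ⟨Fin.cons a w, ?_, Fin.cases hfa hfw⟩
      rw [hcons]
      simp [hw, Multiset.cons_erase ha]

theorem exists_signs_of_existsComplexMasker {n : ℕ} {μ : Fin n → ℝ}
    (h : ExistsComplexMasker 2 (Finset.univ.val.map μ)) :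
    ∃ v : Fin n → ℝ, (∀ l, v l = 1 ∨ v l = -1) ∧ ∑ l, v l * μ l = 0 := by
  obtain ⟨a, b, M, τA, τB, hM, hA, -⟩ := h
  have hf := isMaskFamily_of_isMaskerWith hM
  set X := columns M
  have hpos : τA.PosSemidef := by
    rw [← hf.left_self 0]
    exact Matrix.posSemidef_self_mul_conjTranspose _
  let T := X 1 * (X 0)ᴴ
  -- The diagonal mask relation, skewness and orthogonality of the two columns make i T Hermitian
  -- and traceless with square τ_A².
  have hTT : T * T = -(τA * τA) := hf.mul_self one_ne_zero
  have hTskew : Tᴴ = -T := hf.skew one_ne_zero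
  have hTtr : T.trace = 0 := by
    rw [Matrix.trace_mul_comm, ← conjTranspose_mul_apply, hM.isometry]
    simp
  let K := Complex.I • T
  have hK : K.IsHermitian := by
    change (Complex.I • T)ᴴ = Complex.I • T
    rw [Matrix.conjTranspose_smul, hTskew, Complex.star_def, Complex.conj_I, smul_neg, neg_smul,
      neg_neg]
  have hKK : K * K = τA * τA := by
    change (Complex.I • T) * (Complex.I • T) = _
    rw [Matrix.smul_mul, Matrix.mul_smul, smul_smul, Complex.I_mul_I, hTT]
    simp
  have hKtr : ∑ i, hK.eigenvalues i = 0 := by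
    have h1 := hK.trace_eq_sum_eigenvalues
    have h2 : K.trace = 0 := by
      change (Complex.I • T).trace = 0
      rw [Matrix.trace_smul, hTtr, smul_zero]
    rw [h2] at h1
    have h3 : ((∑ i, hK.eigenvalues i : ℝ) : ℂ) = 0 := by
      rw [Complex.ofReal_sum]
      exact h1.symm
    exact_mod_cast h3
  have hroots : Finset.univ.val.map hpos.isHermitian.eigenvalues =
      Finset.univ.val.map fun i => |hK.eigenvalues i| := by
    have h1 := roots_charpoly_mul_self hK
    rw [hKK, roots_charpoly_mul_self hpos.isHermitian] at h1
    -- Square roots recover absolute values; τ_A is positive semidefinite, so its eigenvalues are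
    -- the absolute values of those of `K`.
    have h2 := congrArg (Multiset.map fun z : ℂ => Real.sqrt z.re) h1
    simp only [Multiset.map_map, Function.comp_def, Complex.ofReal_re, Real.sqrt_mul_self_eq_abs]
      at h2
    rw [← h2]
    refine Multiset.map_congr rfl fun i _ => ?_
    rw [abs_of_nonneg (hpos.eigenvalues_nonneg i)]
  have hmap : ((Finset.univ.val.map hK.eigenvalues).filter (· ≠ 0)).map abs =
      Finset.univ.val.map μ := by
    apply Multiset.map_injective Complex.ofReal_injective
    rw [← hA, nonzeroSpectrum, hpos.isHermitian.roots_charpoly_eq_eigenvalues,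
      ← Multiset.map_map, hroots]
    simp only [Multiset.filter_map, Multiset.map_map, Function.comp_def]
    simp
  obtain ⟨w, hw, hwμ⟩ := exists_eq_map_univ_of_map hmap
  have hwsum : ∑ l, w l = 0 := by
    have h1 : ∀ s : Multiset ℝ, (s.filter (· ≠ 0)).sum = s.sum := fun s => by
      induction s using Multiset.induction_on with
      | empty => simp
      | cons x s ih =>
        by_cases hx : x = 0
        · rw [Multiset.filter_cons_of_neg (p := fun x : ℝ => x ≠ 0) _ (by simp [hx]), ih,
            Multiset.sum_cons, hx, zero_add]
        · rw [Multiset.filter_cons_of_pos (p := fun x : ℝ => x ≠ 0) _ hx, Multiset.sum_cons,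
            Multiset.sum_cons, ih]
    rw [Finset.sum, hw, h1]
    exact hKtr
  refine ⟨fun l => if 0 ≤ w l then 1 else -1, fun l => by
    dsimp only
    split_ifs <;> simp, ?_⟩
  refine (Finset.sum_congr rfl fun l _ => ?_).trans hwsum
  rw [← hwμ]
  beta_reduce
  split_ifs with hl
  · rw [abs_of_nonneg hl, one_mul]
  · rw [abs_of_neg (not_le.1 hl), neg_mul_neg, one_mul]

end Qubit

end QMask

theorem corollary4 :
    (∀ d : ℕ, 3 ≤ d → ∀ (r : ℕ) (lam : Fin r → ℝ) (m : Fin r → ℕ),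
      QMask.IsStateSpectrum lam m →
        (QMask.ExistsComplexMasker d (QMask.spectrumMultiset lam m) ↔
          ∀ o, QMask.kappa d ∣ m o)) ∧
    (∀ d : ℕ, 2 ≤ d → ∀ (r : ℕ) (lam : Fin r → ℝ) (m : Fin r → ℕ),
      QMask.IsStateSpectrum lam m →
        (QMask.ExistsRealMasker d (QMask.spectrumMultiset lam m) ↔
          ∀ o, QMask.kappaR d ∣ m o)) ∧
    (∀ (n : ℕ) (μ : Fin n → ℝ), (∀ l, 0 < μ l) → ∑ l, μ l = 1 →
      (QMask.ExistsComplexMasker 2 (Finset.univ.val.map μ) ↔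
        ∃ v : Fin n → ℝ, (∀ l, v l = 1 ∨ v l = -1) ∧ ∑ l, v l * μ l = 0)) := by
  refine ⟨fun d hd r lam m hs => ?_, fun d hd r lam m hs => ?_, fun n μ hμ hsum => ?_⟩
  · obtain ⟨n, rfl⟩ : ∃ n, d = n + 1 := ⟨d - 1, by omega⟩
    exact ⟨QMask.dvd_of_existsComplexMasker hs,
      QMask.existsComplexMasker_of_dvd (by omega) hs⟩
  · obtain ⟨n, rfl⟩ : ∃ n, d = n + 1 := ⟨d - 1, by omega⟩
    exact ⟨QMask.dvd_of_existsRealMasker hs, QMask.existsRealMasker_of_dvd hs⟩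
  · exact ⟨QMask.exists_signs_of_existsComplexMasker, fun ⟨v, hv, hvμ⟩ =>
      QMask.existsComplexMasker_two hμ hsum hv hvμ⟩
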